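/- **Setting.** Let $\mathcal H$ be a complex Hilbert space, $S_{\mathcal H}$ its unit sphere, $t_0\in\mathbb R$, and consider the system $$\psi'(t)=\Big[H_0(t)+\sum_{l=1}^r u_l(t)H_l(t)\Big]\psi(t),\qquad \psi(t_0)=\psi_0,\quad \psi(t)\in M \text{ for } t\ge t_0, \tag{$*$}$$ with piecewise constant real controls $u_1,\dots,u_r$ (of arbitrary size), under the following standing assumptions. 1. *Analytic domain.* $\mathcal D_A\subset\mathcal H$ is a dense linear subspace and $H_0(t),\dots,H_r(t)$ ($t\ge t_0$) are skew-Hermitian operators $\mathcal D_A\to\mathcal D_A$. For every $t\ge t_0$, $\mathcal D_A$ is an analytic domain for the real Lie algebra $\mathcal A(t)=\mathcal L(H_0(t),\dots,H_r(t))$ generated by these operators under the commutator: for every $A\in\mathcal A(t)$ there is a one-parameter unitary group $(U_\tau)_{\tau\in\mathbb R}$ leaving $\mathcal D_A$ invariant such that for every $\omega\in\mathcal D_A$ there is $s>0$ with $\sum_n \|A^n\omega\|s^n/n!<\infty$ and $U_\tau\omega=\sum_n \tau^nA^n\omega/n!$ for $|\tau|<s$. 2. *State manifold.* $M\subset S_{\mathcal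 H}$ is a connected smooth embedded submanifold of $\mathcal H$ of real dimension $m<\infty$; $M\cap\mathcal D_A$ is dense in $M$ and is itself an $m$-dimensional smooth embedded submanifold. 3. *Vector fields.* For $l=0,\dots,r$, $(t,\psi)\mapsto H_l(t)\psi$ is smooth on $[t_0,\infty)\times(M\cap\mathcal D_A)$, and $H_l(t)\psi$ is tangent to $M\cap\mathcal D_A$ at $\psi$. For $l=1,\dots,r$ and each fixed $s\ge t_0$, the vector field $\psi\mapsto H_l(s)\psi$ is complete on $M\cap\mathcal D_A$. 4. *Dynamics on $M$.* For all $t_0\le s\le t$, every $\varphi\in M\cap\mathcal D_A$ and every piecewise constant control on $[s,t]$ there is a solution of the equation in $(*)$ on $[s,t]$ that starts at $\varphi$ at time $s$ and stays in $M\cap\mathcal D_A$. A solution is a norm-continuous curve in $M\cap\mathcal D_A$ satisfying the differential equation in $\mathcal H$ except at the switching times of the control. For $\psi_0\in M\cap\mathcal D_A$ and $t>t_0$ let $R_t(\psi_0)$ be the set of all $\psi(t)$, where $\psi$ is a solution on $[t_0,t]$ with $\psi(t_0)=\psi_0$ for some piecewise constant control. The system is *strongly analytically controllable* on $M$ if $R_t(\psi_0)=M\cap\mathcal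 D_A$ for all $t>t_0$ and all $\psi_0\in M\cap\mathcal D_A$. **Corollary.** Let $\mathcal B(t)=\mathcal L(H_1(t),\dots,H_r(t))$ be the real Lie algebra generated by the control operators, and suppose that the real vector space $\mathcal B(t)\psi=\{Y\psi : Y\in\mathcal B(t)\}$ satisfies $$\dim_{\mathbb R}\mathcal B(t)\psi=m\qquad\text{for all } t\ge t_0 \text{ and all } \psi\in M\cap\mathcal D_A .$$ Then the system $(*)$ is strongly analytically controllable on $M$. -/

import Mathlib

open scoped ContDiff InnerProductSpace Topology Nat

namespace QuantumControl

/- The Lie bracket of operators is the commutator `[A, B] = A B - B A`. -/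
attribute [local instance] LieRing.ofAssociativeRing

section Geometry

variable {H : Type*} [NormedAddCommGroup H] [InnerProductSpace ℂ H]

/-- `e` is a smooth chart of the subset `M` of the (real) Hilbert space `H`: its domain is open in
`M` for the inherited topology, and its inverse is a smooth immersion of an open subset of `ℝᵐ`
into `H`. -/
structure IsSmoothChart {m : ℕ} {M : Set H}
    (e : OpenPartialHomeomorph M (EuclideanSpace ℝ (Fin m))) : Prop where
  contDiffOn : ContDiffOn ℝ ∞ (fun v => (e.symm v : H)) e.target
  injective : ∀ v ∈ e.target, Function.Injective (fderiv ℝ (fun v => (e.symm v : H)) v)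

/-- `M` is an `m`-dimensional smooth embedded submanifold of `H` (real dimension `m`). -/
def IsSubmanifold (m : ℕ) (M : Set H) : Prop :=
  ∀ p : M, ∃ e : OpenPartialHomeomorph M (EuclideanSpace ℝ (Fin m)),
    p ∈ e.source ∧ IsSmoothChart e

end Geometry

section Operators

variable {H : Type*} [NormedAddCommGroup H] [InnerProductSpace ℂ H] {D : Submodule ℂ H}

/-- Skew-Hermitian operators with invariant domain `D`. -/
def IsSkewHermitian (A : Module.End ℂ D) : Prop :=
  ∀ x y : D, ⟪(A x : H), (y : H)⟫_ℂ = -⟪(x : H), (A y : H)⟫_ℂ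

/-- `U` is a one-parameter group of unitary operators, defined for all times, which leaves `D`
invariant and is given on `D` by the exponential of `A`: every `x ∈ D` is an analytic vector of `A`
(the series `∑ ‖Aⁿ x‖ sⁿ / n!` converges for some `s > 0`) and
`U t x = ∑ (tⁿ / n!) Aⁿ x` for `|t| < s`. -/
structure IsUnitaryExp (A : Module.End ℂ D) (U : ℝ → (H ≃ₗᵢ[ℂ] H)) : Prop where
  map_add : ∀ (s t : ℝ) (x : H), U (s + t) x = U s (U t x)
  mapsTo : ∀ (t : ℝ), ∀ x ∈ D, U t x ∈ D
  exp_series : ∀ x : D, ∃ s : ℝ, 0 < s ∧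
    Summable (fun n : ℕ => ‖((A ^ n) x : H)‖ / (n ! : ℝ) * s ^ n) ∧
    ∀ t : ℝ, |t| < s →
      HasSum (fun n : ℕ => (t ^ n / (n ! : ℝ)) • ((A ^ n) x : H)) (U t (x : H))

/-- `D` is an analytic domain for the real Lie algebra `L` of operators on `D`: it is dense, it is
invariant under `L` (the elements of `L` are endomorphisms of `D`), and every element of `L`
exponentiates to a unitary one-parameter group, given by the exponential series locally on `D`,
defined for all times and leaving `D` invariant. The corresponding unitary group is the one
generated by these one-parameter groups, so that it leaves `D` invariant as well. -/
structure IsAnalyticDomain (D : Submodule ℂ H) (L : LieSubalgebra ℝ (Module.End ℂ D)) : Prop where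
  dense : Dense (D : Set H)
  exists_exp : ∀ A ∈ L, ∃ U : ℝ → (H ≃ₗᵢ[ℂ] H), IsUnitaryExp A U

/-- Evaluation of operators at a vector `ψ ∈ D`, as a real-linear map with values in `H`. -/
noncomputable def evalAt (ψ : D) : Module.End ℂ D →ₗ[ℝ] H where
  toFun A := (A ψ : H)
  map_add' _ _ := rfl
  map_smul' _ _ := rfl

/-- The real vector space `L ψ = {Y ψ | Y ∈ L}`. -/
noncomputable def restrictAt (L : LieSubalgebra ℝ (Module.End ℂ D)) (ψ : D) : Submodule ℝ H :=
  L.toSubmodule.map (evalAt ψ)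

/-- The time-dependent family `A t` (`t ≥ t₀`) of operators on `D` is a smooth time-dependent
vector field on the manifold `M ∩ D`: in every smooth chart of `M ∩ D` the map `(t, ψ) ↦ A t ψ` is
smooth, and `A t ψ` is tangent to `M ∩ D` at `ψ`. -/
structure IsSmoothVectorField (m : ℕ) (M : Set H) (t₀ : ℝ) (A : ℝ → Module.End ℂ D) : Prop where
  contDiffOn : ∀ e : OpenPartialHomeomorph ↥(M ∩ (D : Set H)) (EuclideanSpace ℝ (Fin m)),
    IsSmoothChart e →
      ContDiffOn ℝ ∞
        (fun q : ℝ × EuclideanSpace ℝ (Fin m) =>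
          (A q.1 (⟨(e.symm q.2 : H), (e.symm q.2).2.2⟩ : D) : H))
        (Set.Ici t₀ ×ˢ e.target)
  tangent : ∀ e : OpenPartialHomeomorph ↥(M ∩ (D : Set H)) (EuclideanSpace ℝ (Fin m)),
    IsSmoothChart e → ∀ t, t₀ ≤ t → ∀ v ∈ e.target,
      (A t (⟨(e.symm v : H), (e.symm v).2.2⟩ : D) : H) ∈
        Set.range (fderiv ℝ (fun w => (e.symm w : H)) v)

end Operators

/-- The control `u` is locally constant at time `t`. -/
def IsLocallyConstAt {r : ℕ} (u : ℝ → Fin r → ℝ) (t : ℝ) : Prop :=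
  ∀ᶠ s in 𝓝 t, u s = u t

/-- The control `u` is piecewise constant on `[a, b]`: constant off finitely many switching times. -/
def IsPiecewiseConst {r : ℕ} (u : ℝ → Fin r → ℝ) (a b : ℝ) : Prop :=
  ∃ F : Finset ℝ, ∀ t ∈ Set.Ioo a b, t ∉ F → IsLocallyConstAt u t

/-- The data of a time-dependent quantum control system
`ψ'(t) = (H₀(t) + ∑ l, u l (t) • H l (t)) ψ(t)` with `r` controls: a common invariant domain,
the drift operator and the control operators. -/
structure ControlSystem (H : Type*) [NormedAddCommGroup H] [InnerProductSpace ℂ H] (r : ℕ) where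
  domain : Submodule ℂ H
  drift : ℝ → Module.End ℂ domain
  control : Fin r → ℝ → Module.End ℂ domain

namespace ControlSystem

variable {H : Type*} [NormedAddCommGroup H] [InnerProductSpace ℂ H] {r : ℕ}
  (S : ControlSystem H r)

/-- The real Lie algebra generated by all the operators `H₀(t), H₁(t), …, H_r(t)`. -/
noncomputable def lieA (t : ℝ) : LieSubalgebra ℝ (Module.End ℂ S.domain) :=
  LieSubalgebra.lieSpan ℝ _ (insert (S.drift t) (Set.range fun l => S.control l t))

/-- The real Lie algebra generated by the control operators `H₁(t), …, H_r(t)`. -/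
noncomputable def lieB (t : ℝ) : LieSubalgebra ℝ (Module.End ℂ S.domain) :=
  LieSubalgebra.lieSpan ℝ _ (Set.range fun l => S.control l t)

/-- The right-hand side operator `H₀(t) + ∑ l, c l • H l (t)`. -/
noncomputable def generator (c : Fin r → ℝ) (t : ℝ) : Module.End ℂ S.domain :=
  S.drift t + ∑ l, c l • S.control l t

/-- `ψ` solves the controlled Schrödinger equation on `[a, b]` with control `u` and evolves in
`M ∩ domain`: it is continuous in the norm of `H`, and the equation holds (norm derivative in `H`)
at all times of `(a, b)` but the switching times of `u`. -/
structure IsTrajectory (M : Set H) (u : ℝ → Fin r → ℝ) (a b : ℝ) (ψ : ℝ → S.domain) : Prop where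
  continuousOn : ContinuousOn (fun t => (ψ t : H)) (Set.Icc a b)
  mem : ∀ t ∈ Set.Icc a b, (ψ t : H) ∈ M
  hasDerivAt : ∀ t ∈ Set.Ioo a b, IsLocallyConstAt u t →
    HasDerivAt (fun s => (ψ s : H)) (S.generator (u t) t (ψ t) : H) t

/-- The set `R_t(ψ₀)` of all points reachable at time `t` from `ψ₀` at time `t₀` by
piecewise constant real controls. -/
def reachable (M : Set H) (t₀ t : ℝ) (ψ₀ : S.domain) : Set H :=
  {χ | ∃ (u : ℝ → Fin r → ℝ) (ψ : ℝ → S.domain), IsPiecewiseConst u t₀ t ∧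
    S.IsTrajectory M u t₀ t ψ ∧ ψ t₀ = ψ₀ ∧ (ψ t : H) = χ}

/-- Strong analytic controllability on `M`: `R_t(ψ₀) = M ∩ domain` for all `t > t₀` and all
`ψ₀ ∈ M ∩ domain`. -/
def IsStronglyAnalyticallyControllable (M : Set H) (t₀ : ℝ) : Prop :=
  ∀ t, t₀ < t → ∀ ψ₀ : S.domain, (ψ₀ : H) ∈ M →
    S.reachable M t₀ t ψ₀ = M ∩ (S.domain : Set H)

/-- The standing assumptions on a system considered for times `t ≥ t₀` on an `m`-dimensional
submanifold `M` of the unit sphere: the operators are skew-Hermitian, `domain` is an analytic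
domain, `M ∩ domain` is dense in `M` and of the same dimension `m`, the operators are smooth vector
fields on `M ∩ domain`, and the dynamics prevail on `M`. -/
structure IsSystemOn (t₀ : ℝ) (m : ℕ) (M : Set H) : Prop where
  skew_drift : ∀ t, t₀ ≤ t → IsSkewHermitian (S.drift t)
  skew_control : ∀ l t, t₀ ≤ t → IsSkewHermitian (S.control l t)
  analytic : ∀ t, t₀ ≤ t → IsAnalyticDomain S.domain (S.lieA t)
  subset_sphere : M ⊆ Metric.sphere 0 1
  connected : IsConnected M
  submanifold : IsSubmanifold m M
  submanifold_inter : IsSubmanifold m (M ∩ (S.domain : Set H))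
  dense_inter : M ⊆ closure (M ∩ (S.domain : Set H))
  smooth_drift : IsSmoothVectorField m M t₀ S.drift
  smooth_control : ∀ l, IsSmoothVectorField m M t₀ (S.control l)
  /-- For each fixed time `s` the vector field of a control operator is complete on
  `M ∩ domain`: its integral curves in `M ∩ domain` are defined for all real times. -/
  complete_control : ∀ l s, t₀ ≤ s → ∀ χ : S.domain, (χ : H) ∈ M →
    ∃ γ : ℝ → S.domain, γ 0 = χ ∧ (∀ τ, (γ τ : H) ∈ M) ∧
      ∀ τ, HasDerivAt (fun σ => (γ σ : H)) (S.control l s (γ τ) : H) τ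
  /-- The dynamics prevail on `M`: from every point of `M ∩ domain`, at every starting time, every
  piecewise constant control drives a solution which stays in `M ∩ domain`. -/
  dynamics : ∀ s t, t₀ ≤ s → s ≤ t → ∀ u, IsPiecewiseConst u s t →
    ∀ χ : S.domain, (χ : H) ∈ M → ∃ ψ : ℝ → S.domain, S.IsTrajectory M u s t ψ ∧ ψ s = χ

end ControlSystem

end QuantumControl

/-! Fix `T > t₀` and two states `ψ₀`, `χ`. A pulse of amplitude `a / ε` on the `l`-th control,
lasting a time `ε` close to `T`, acts as `ε ↓ 0` like the flow of the frozen operator `S.control l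
T` for time `a`; the drift has no time to act. So one follows the zero control from `ψ₀` almost
until `T`, along a trajectory `ξ`, and spends the remaining short time on a word of pulses. The
endpoint tends to the image of `ξ T` under the corresponding word of frozen flows.

These words act transitively on `M ∩ D` (`exists_flowWord_eq`). The rank condition makes orbits
open; the flows are isometries, so compactness of small balls in an orbit holds with one radius at
all its points, which makes the orbit closed in `H`; connectedness and density do the rest. Hence a
word `v` takes `ξ T` to `χ`, but pulses realise this only in the limit. To hit `χ` exactly, a word
`w` depending on a parameter `θ` is appended, fixing `χ` at `θ = 0` and submersive there
(`exists_submersion`). The true endpoint is a perturbation of this submersion that is small together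
with its Lipschitz constant in `θ` (`tendsToZeroLip_word`), and such a perturbation still attains
the value `χ` (`TendsToZeroLip.eventually_exists_eq`).

Skew symmetry replaces boundedness of the operators in two ways. It gives an energy estimate in
which errors grow only through the residual and never through the generator, so amplitudes of order
`1 / ε` cost no exponential factor. It also makes the operators closable, so that they commute with
differentiation along curves in `M ∩ D`; hence commutators of tangent operators are again tangent.
-/

namespace QuantumControl

attribute [local instance] LieRing.ofAssociativeRing

/-! ### Energy estimates and closability for skew-Hermitian operators. -/

section SkewEstimates

variable {H : Type*} [NormedAddCommGroup H] [InnerProductSpace ℂ H] {D : Submodule ℂ H}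

/-- A differential inequality: if the radial part of the velocity of `d` is bounded by `ρ`, then
`‖d‖` grows at most at rate `ρ`. -/
theorem norm_le_of_re_inner_le {d d' : ℝ → H} {a b ρ : ℝ} (hab : a ≤ b) (hρ : 0 ≤ ρ)
    (hc : ContinuousOn d (Set.Icc a b))
    (hd : ∀ t ∈ Set.Ioo a b, HasDerivAt d (d' t) t)
    (hi : ∀ t ∈ Set.Ioo a b, (⟪d t, d' t⟫_ℂ).re ≤ ρ * ‖d t‖) :
    ‖d b‖ ≤ ‖d a‖ + ρ * (b - a) := by
  let _ : InnerProductSpace ℝ H := InnerProductSpace.rclikeToReal ℂ H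
  -- The norm is not differentiable at zeros of `d`, so `√(‖d‖² + δ²)` is estimated instead and `δ`
  -- is removed at the end.
  have key : ∀ δ : ℝ, 0 < δ → ‖d b‖ ≤ ‖d a‖ + δ + ρ * (b - a) := by
    intro δ hδ
    have hpos : ∀ t, 0 < ‖d t‖ ^ 2 + δ ^ 2 := fun t => by positivity
    have hder : ∀ t ∈ Set.Ioo a b, HasDerivAt (fun t => Real.sqrt (‖d t‖ ^ 2 + δ ^ 2))
        (2 * ⟪d t, d' t⟫_ℝ / (2 * Real.sqrt (‖d t‖ ^ 2 + δ ^ 2))) t := by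
      intro t ht
      have h1 := ((hd t ht).norm_sq).add_const (δ ^ 2)
      exact h1.sqrt (hpos t).ne'
    have h := (convex_Icc a b).image_sub_le_mul_sub_of_deriv_le
      (f := fun t => Real.sqrt (‖d t‖ ^ 2 + δ ^ 2)) (C := ρ) (by fun_prop)
      (fun t ht => by
        rw [interior_Icc] at ht
        exact (hder t ht).differentiableAt.differentiableWithinAt)
      (fun t ht => by
        rw [interior_Icc] at ht
        rw [(hder t ht).deriv]
        have h2 := hi t ht
        have h3 : ⟪d t, d' t⟫_ℝ = (⟪d t, d' t⟫_ℂ).re := rfl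
        have hs : 0 < Real.sqrt (‖d t‖ ^ 2 + δ ^ 2) := Real.sqrt_pos.2 (hpos t)
        rw [div_le_iff₀ (by positivity), h3]
        have h4 : ‖d t‖ ≤ Real.sqrt (‖d t‖ ^ 2 + δ ^ 2) :=
          Real.le_sqrt_of_sq_le (by nlinarith)
        nlinarith [mul_le_mul_of_nonneg_left h4 hρ])
      a (Set.left_mem_Icc.2 hab) b (Set.right_mem_Icc.2 hab) hab
    have h5 : ‖d b‖ ≤ Real.sqrt (‖d b‖ ^ 2 + δ ^ 2) := Real.le_sqrt_of_sq_le (by nlinarith)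
    have h6 : Real.sqrt (‖d a‖ ^ 2 + δ ^ 2) ≤ ‖d a‖ + δ :=
      Real.sqrt_le_iff.2 ⟨by positivity, by nlinarith [norm_nonneg (d a)]⟩
    linarith
  refine le_of_forall_pos_le_add fun δ hδ => ?_
  linarith [key δ hδ]

namespace IsSkewHermitian

theorem re_inner_self {A : Module.End ℂ D} (hA : IsSkewHermitian A) (x : D) :
    (⟪(x : H), (A x : H)⟫_ℂ).re = 0 := by
  have h := congrArg Complex.re (hA x x)
  rw [← inner_conj_symm (A x : H) (x : H)] at h
  simp only [Complex.conj_re, Complex.neg_re] at h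
  linarith

theorem zero : IsSkewHermitian (0 : Module.End ℂ D) := fun x y => by simp

theorem add {A B : Module.End ℂ D} (hA : IsSkewHermitian A) (hB : IsSkewHermitian B) :
    IsSkewHermitian (A + B) := fun x y => by
  have h1 : (((A + B) x : D) : H) = (A x : H) + (B x : H) := rfl
  have h2 : (((A + B) y : D) : H) = (A y : H) + (B y : H) := rfl
  rw [h1, h2, inner_add_left, inner_add_right, hA x y, hB x y, neg_add]

theorem smul {A : Module.End ℂ D} (hA : IsSkewHermitian A) (c : ℝ) :
    IsSkewHermitian (c • A) := fun x y => by
  have h1 : (((c • A) x : D) : H) = (c : ℂ) • (A x : H) := rfl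
  have h2 : (((c • A) y : D) : H) = (c : ℂ) • (A y : H) := rfl
  rw [h1, h2, inner_smul_left, inner_smul_right, hA x y]
  simp

theorem lie {A B : Module.End ℂ D} (hA : IsSkewHermitian A) (hB : IsSkewHermitian B) :
    IsSkewHermitian ⁅A, B⁆ := fun x y => by
  have h (z : D) : ((⁅A, B⁆ z : D) : H) = (A (B z) : H) - (B (A z) : H) := rfl
  rw [h, h, inner_sub_left, inner_sub_right, hA (B x) y, hB x (A y), hB (A x) y, hA x (B y)]
  ring

/-- A densely defined skew-Hermitian operator is closable. -/
theorem eq_of_tendsto {A : Module.End ℂ D} (hA : IsSkewHermitian A) (hD : Dense (D : Set H))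
    {ι : Type*} {l : Filter ι} [l.NeBot] {f : ι → D} {x : D} {z : H}
    (hf : Filter.Tendsto (fun i => (f i : H)) l (𝓝 x))
    (hz : Filter.Tendsto (fun i => (A (f i) : H)) l (𝓝 z)) : (A x : H) = z := by
  refine hD.eq_of_inner_left (𝕜 := ℂ) fun y hy => ?_
  have h1 : Filter.Tendsto (fun i => ⟪(A (f i) : H), y⟫_ℂ) l (𝓝 ⟪z, y⟫_ℂ) :=
    hz.inner tendsto_const_nhds
  have h2 : Filter.Tendsto (fun i => -⟪(f i : H), (A ⟨y, hy⟩ : H)⟫_ℂ) l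
      (𝓝 (-⟪(x : H), (A ⟨y, hy⟩ : H)⟫_ℂ)) := (hf.inner tendsto_const_nhds).neg
  rw [hA x ⟨y, hy⟩]
  refine tendsto_nhds_unique h2 (h1.congr fun i => ?_)
  exact hA (f i) ⟨y, hy⟩

/-- Closability along curves: if `f` and `A f` are differentiable and `f'(0) ∈ D`, then
`(A f)'(0) = A f'(0)`. -/
theorem apply_eq_of_hasDerivAt {A : Module.End ℂ D} (hA : IsSkewHermitian A)
    (hD : Dense (D : Set H)) {f : ℝ → D} {x : D} {z : H} {t : ℝ}
    (hf : HasDerivAt (fun s => (f s : H)) x t)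
    (hz : HasDerivAt (fun s => (A (f s) : H)) z t) : (A x : H) = z := by
  rw [hasDerivAt_iff_tendsto_slope] at hf hz
  refine hA.eq_of_tendsto hD (l := 𝓝[≠] t) (f := fun s => ((s - t)⁻¹ : ℝ) • (f s - f t)) ?_ ?_
  · refine hf.congr fun s => ?_
    simp [slope_def_module]
  · refine hz.congr fun s => ?_
    have : A (((s - t)⁻¹ : ℝ) • (f s - f t)) = ((s - t)⁻¹ : ℝ) • (A (f s) - A (f t)) := by
      rw [LinearMap.map_smul_of_tower, map_sub]
    rw [this]
    simp [slope_def_module]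

/-- A solution of a linear equation with skew-Hermitian generators and a forcing term bounded by `ρ`
grows in norm at most at rate `ρ`. -/
theorem norm_sub_le {A : ℝ → Module.End ℂ D} {a b ρ : ℝ} (hab : a ≤ b) (hρ : 0 ≤ ρ)
    (hA : ∀ t ∈ Set.Ioo a b, IsSkewHermitian (A t)) {d : ℝ → D} {R : ℝ → H}
    (hc : ContinuousOn (fun t => (d t : H)) (Set.Icc a b))
    (hd : ∀ t ∈ Set.Ioo a b, HasDerivAt (fun t => (d t : H)) ((A t (d t) : H) + R t) t)
    (hR : ∀ t ∈ Set.Ioo a b, ‖R t‖ ≤ ρ) : ‖(d b : H)‖ ≤ ‖(d a : H)‖ + ρ * (b - a) := by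
  refine norm_le_of_re_inner_le hab hρ hc hd fun t ht => ?_
  rw [inner_add_right, Complex.add_re, (hA t ht).re_inner_self, zero_add]
  refine (Complex.re_le_norm _).trans ((norm_inner_le_norm _ _).trans ?_)
  rw [mul_comm]
  exact mul_le_mul_of_nonneg_right (hR t ht) (norm_nonneg _)

end IsSkewHermitian

end SkewEstimates

/-! ### Unitary groups as flows of isometries of `D`. -/

section Flows

variable {H : Type*} [NormedAddCommGroup H] [InnerProductSpace ℂ H] {D : Submodule ℂ H}

theorem hasDerivAt_coe_iff {f : ℝ → D} {x : D} {t : ℝ} :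
    HasDerivAt (fun s => (f s : H)) x t ↔ HasDerivAt f x t := by
  rw [hasDerivAt_iff_isLittleO, hasDerivAt_iff_isLittleO, ← Asymptotics.isLittleO_norm_left]
  conv_rhs => rw [← Asymptotics.isLittleO_norm_left]
  rfl

/-- A one-parameter group of isometries of `D` with infinitesimal generator `A`. -/
structure IsFlow (A : Module.End ℂ D) (U : ℝ → (D ≃ₗᵢ[ℂ] D)) : Prop where
  map_add : ∀ (s t : ℝ) (x : D), U (s + t) x = U s (U t x)
  hasDerivAt : ∀ (x : D) (t : ℝ), HasDerivAt (fun s => U s x) (A (U t x)) t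

namespace IsUnitaryExp

variable {A : Module.End ℂ D} {U : ℝ → (H ≃ₗᵢ[ℂ] H)}

theorem map_zero (h : IsUnitaryExp A U) (x : H) : U 0 x = x :=
  (U 0).injective (by rw [← h.map_add, add_zero])

/-- The tail of the exponential series from order two is at most `(C / s²) |t|²`, because `|t| ^ (n
+ 2) ≤ (|t|² / s²) s ^ (n + 2)` for `|t| < s`. -/
theorem hasDerivAt_zero (h : IsUnitaryExp A U) (x : D) :
    HasDerivAt (fun s => U s (x : H)) (A x : H) 0 := by
  obtain ⟨s, hs, hsum, hU⟩ := h.exp_series x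
  set C := ∑' n : ℕ, ‖((A ^ n) x : H)‖ / (n ! : ℝ) * s ^ n
  have hnn : ∀ n : ℕ, 0 ≤ ‖((A ^ n) x : H)‖ / (n ! : ℝ) * s ^ n := fun n => by positivity
  have key : ∀ t : ℝ, |t| < s → ‖U t (x : H) - x - t • (A x : H)‖ ≤ (C / s ^ 2) * |t| ^ 2 := by
    intro t ht
    have h1 := hU t ht
    have h2 : HasSum (fun n : ℕ => (t ^ (n + 2) / ((n + 2)! : ℝ)) • ((A ^ (n + 2)) x : H))
        (U t (x : H) - x - t • (A x : H)) := by
      have := (hasSum_nat_add_iff' 2).2 h1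
      simpa [Finset.sum_range_succ, sub_sub] using this
    have h3 : Summable (fun n : ℕ => ‖((A ^ (n + 2)) x : H)‖ / ((n + 2)! : ℝ) * s ^ (n + 2)) :=
      (summable_nat_add_iff 2).2 hsum
    have h4 : ∑' n : ℕ, ‖((A ^ (n + 2)) x : H)‖ / ((n + 2)! : ℝ) * s ^ (n + 2) ≤ C := by
      have := hsum.sum_add_tsum_nat_add 2
      have h5 : 0 ≤ ∑ i ∈ Finset.range 2, ‖((A ^ i) x : H)‖ / (i ! : ℝ) * s ^ i :=
        Finset.sum_nonneg fun i _ => hnn i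
      linarith
    have h5 := h3.hasSum.mul_left (|t| ^ 2 / s ^ 2)
    refine (h2.norm_le_of_bounded h5 fun n => ?_).trans ?_
    · rw [norm_smul, norm_div, norm_pow, Real.norm_eq_abs]
      simp only [RCLike.norm_natCast]
      have : |t| ^ n ≤ s ^ n := pow_le_pow_left₀ (abs_nonneg _) ht.le n
      calc |t| ^ (n + 2) / ((n + 2)! : ℝ) * ‖((A ^ (n + 2)) x : H)‖
          = |t| ^ n * (|t| ^ 2 / ((n + 2)! : ℝ) * ‖((A ^ (n + 2)) x : H)‖) := by ring
        _ ≤ s ^ n * (|t| ^ 2 / ((n + 2)! : ℝ) * ‖((A ^ (n + 2)) x : H)‖) :=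
            mul_le_mul_of_nonneg_right this (by positivity)
        _ = _ := by rw [pow_add s n 2]; field_simp
    · calc |t| ^ 2 / s ^ 2 * ∑' n : ℕ, ‖((A ^ (n + 2)) x : H)‖ / ((n + 2)! : ℝ) * s ^ (n + 2)
          ≤ |t| ^ 2 / s ^ 2 * C := mul_le_mul_of_nonneg_left h4 (by positivity)
        _ = _ := by ring
  rw [hasDerivAt_iff_isLittleO_nhds_zero]
  have hO : (fun t : ℝ => U (0 + t) (x : H) - U 0 (x : H) - t • (A x : H)) =O[𝓝 0]
      fun t : ℝ => |t| ^ 2 := by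
    refine Asymptotics.IsBigO.of_bound (C / s ^ 2) ?_
    filter_upwards [Metric.ball_mem_nhds (0 : ℝ) hs] with t ht
    rw [h.map_zero, zero_add, Real.norm_of_nonneg (by positivity)]
    exact key t (by simpa using ht)
  refine hO.trans_isLittleO ?_
  simp only [sq_abs]
  exact Asymptotics.isLittleO_pow_id one_lt_two

/-- The unitary group of an operator with invariant domain `D` restricts to a flow on `D`. -/
theorem exists_isFlow (h : IsUnitaryExp A U) :
    ∃ V : ℝ → (D ≃ₗᵢ[ℂ] D), IsFlow A V := by
  have hinv : ∀ (t : ℝ) (x : H), U (-t) (U t x) = x := fun t x => by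
    rw [← h.map_add, neg_add_cancel, h.map_zero]
  have hinv' : ∀ (t : ℝ) (x : H), U t (U (-t) x) = x := fun t x => by
    rw [← h.map_add, add_neg_cancel, h.map_zero]
  let V : ℝ → (D ≃ₗᵢ[ℂ] D) := fun t =>
    { toFun := fun x => ⟨U t x, h.mapsTo t x x.2⟩
      invFun := fun x => ⟨U (-t) x, h.mapsTo (-t) x x.2⟩
      left_inv := fun x => Subtype.ext (hinv t x)
      right_inv := fun x => Subtype.ext (hinv' t x)
      map_add' := fun x y => Subtype.ext (by simp)
      map_smul' := fun c x => Subtype.ext (by simp)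
      norm_map' := fun x => (U t).norm_map x }
  have hV : ∀ t x, ((V t x : D) : H) = U t x := fun t x => rfl
  refine ⟨V, ⟨fun s t x => Subtype.ext ?_, fun x t => ?_⟩⟩
  · simp only [hV, h.map_add]
  · rw [← hasDerivAt_coe_iff]
    have h1 := h.hasDerivAt_zero (V t x)
    rw [← sub_self t] at h1
    have h2 := HasDerivAt.comp_sub_const t t h1
    refine h2.congr_of_eventuallyEq (Filter.Eventually.of_forall fun s => ?_)
    simp only [hV, ← h.map_add, sub_add_cancel]

end IsUnitaryExp

namespace IsFlow

variable {A : Module.End ℂ D} {U : ℝ → (D ≃ₗᵢ[ℂ] D)}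

theorem map_zero (h : IsFlow A U) (x : D) : U 0 x = x :=
  (U 0).injective (by rw [← h.map_add, add_zero])

theorem apply_neg (h : IsFlow A U) (t : ℝ) (x : D) : U t (U (-t) x) = x := by
  rw [← h.map_add, add_neg_cancel, h.map_zero]

theorem hasDerivAt_comp_isometry (V : D ≃ₗᵢ[ℂ] D) {f : ℝ → D} {x : D} {t : ℝ}
    (hf : HasDerivAt f x t) : HasDerivAt (fun s => V (f s)) (V x) t := by
  have := ((V.toContinuousLinearEquiv : D →L[ℂ] D).restrictScalars ℝ).hasFDerivAt.comp_hasDerivAt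
    t hf
  exact this

/-- Strong continuity becomes joint continuity because each `U t` is an isometry. -/
theorem continuous_uncurry (h : IsFlow A U) : Continuous fun q : ℝ × D => U q.1 q.2 := by
  rw [continuous_iff_continuousAt]
  rintro ⟨t, x⟩
  rw [ContinuousAt, tendsto_iff_dist_tendsto_zero]
  have h1 : Filter.Tendsto (fun q : ℝ × D => dist q.2 x + dist (U q.1 x) (U t x)) (𝓝 (t, x))
      (𝓝 (0 + 0)) := by
    refine Filter.Tendsto.add ?_ ?_
    · have : Continuous fun q : ℝ × D => dist q.2 x := by fun_prop
      simpa using this.tendsto (t, x)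
    · rw [← tendsto_iff_dist_tendsto_zero]
      exact (h.hasDerivAt x t).continuousAt.tendsto.comp continuousAt_fst
  rw [add_zero] at h1
  refine squeeze_zero (fun _ => dist_nonneg) (fun q => ?_) h1
  calc dist (U q.1 q.2) (U t x) ≤ dist (U q.1 q.2) (U q.1 x) + dist (U q.1 x) (U t x) :=
        dist_triangle _ _ _
    _ = _ := by rw [(U q.1).dist_map]

/-- An integral curve of the generator is an orbit of the flow. -/
theorem eq_of_hasDerivAt (h : IsFlow A U) (hA : IsSkewHermitian A) {γ : ℝ → D}
    (hγ : ∀ t, HasDerivAt (fun s => (γ s : H)) (A (γ t) : H) t) (t : ℝ) :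
    U t (γ 0) = γ t := by
  have hd : ∀ a t, HasDerivAt (fun s => ((U s a - γ s : D) : H)) (A (U t a - γ t) : H) t := by
    intro a t
    have := (hasDerivAt_coe_iff.2 (h.hasDerivAt a t)).sub (hγ t)
    rw [map_sub, Submodule.coe_sub]
    exact this
  have key : ∀ a b s, s ≤ b → U s a = γ s → U b a = γ b := by
    intro a b s hsb hs
    have := IsSkewHermitian.norm_sub_le (A := fun _ => A) (R := 0) (ρ := 0) hsb le_rfl
      (fun _ _ => hA) (d := fun s => U s a - γ s)
      (fun s _ => (hd a s).continuousAt.continuousWithinAt)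
      (fun s _ => by simpa using hd a s) (by simp)
    simp only [hs, sub_self, Submodule.coe_zero, norm_zero, zero_mul, add_zero] at this
    have h2 := norm_le_zero_iff.1 this
    exact sub_eq_zero.1 (Subtype.ext h2)
  rcases le_total 0 t with ht | ht
  · exact key _ t 0 ht (h.map_zero _)
  · have h1 := key (U (-t) (γ t)) 0 t ht (h.apply_neg _ _)
    rw [h.map_zero] at h1
    rw [← h1, h.apply_neg]

end IsFlow

end Flows

/-! ### Charts of `M ∩ D`, tangent operators and their commutators. -/

section Charts

variable {H : Type*} [NormedAddCommGroup H] [InnerProductSpace ℂ H] {D : Submodule ℂ H}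
  {m : ℕ} {M : Set H}

/-- The set `M ∩ D` as a subset of `D`. -/
abbrev states (D : Submodule ℂ H) (M : Set H) : Set D := {y | (y : H) ∈ M}

/-- An injective linear map from a finite-dimensional space has a continuous left inverse. -/
theorem exists_continuous_leftInverse {E F : Type*} [NormedAddCommGroup E] [NormedSpace ℝ E]
    [FiniteDimensional ℝ E] [NormedAddCommGroup F] [NormedSpace ℝ F] (L : E →L[ℝ] F)
    (hL : Function.Injective L) : ∃ P : F →L[ℝ] E, ∀ v, P (L v) = v := by
  let eL := LinearEquiv.ofInjective (L : E →ₗ[ℝ] F) hL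
  have : FiniteDimensional ℝ (LinearMap.range (L : E →ₗ[ℝ] F)) := eL.finiteDimensional
  obtain ⟨P, hP⟩ := ContinuousLinearMap.exist_extension_of_finiteDimensional_range
    (LinearMap.toContinuousLinearMap eL.symm.toLinearMap)
  refine ⟨P, fun v => ?_⟩
  have h1 := congrArg (fun f => f (eL v)) hP
  have h2 : ((eL v : LinearMap.range (L : E →ₗ[ℝ] F)) : F) = L v := rfl
  simpa [h2] using h1.symm

/-- An immersion has a smooth local left inverse of the form `g ∘ P` with `P` linear. -/
theorem exists_local_leftInverse {E F : Type*} [NormedAddCommGroup E] [NormedSpace ℝ E]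
    [FiniteDimensional ℝ E] [NormedAddCommGroup F] [NormedSpace ℝ F] {θ : E → F} {q₀ : E}
    (hθ : ContDiffAt ℝ ∞ θ q₀) (hinj : Function.Injective (fderiv ℝ θ q₀)) :
    ∃ (P : F →L[ℝ] E) (g : E → E), (∀ v, P (fderiv ℝ θ q₀ v) = v) ∧
      ContDiffAt ℝ ∞ (fun y => g (P y)) (θ q₀) ∧ ∀ᶠ q in 𝓝 q₀, g (P (θ q)) = q := by
  have : CompleteSpace E := FiniteDimensional.complete ℝ E
  obtain ⟨P, hP⟩ := exists_continuous_leftInverse _ hinj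
  have h1 : ContDiffAt ℝ ∞ (fun q => P (θ q)) q₀ := P.contDiff.contDiffAt.comp q₀ hθ
  have h2 : HasFDerivAt (fun q => P (θ q)) ((ContinuousLinearEquiv.refl ℝ E : E →L[ℝ] E)) q₀ := by
    have h3 := P.hasFDerivAt.comp q₀ (hθ.differentiableAt (by simp)).hasFDerivAt
    have h4 : P.comp (fderiv ℝ θ q₀) = (ContinuousLinearEquiv.refl ℝ E : E →L[ℝ] E) := by
      ext v; simp [hP]
    rwa [h4] at h3
  refine ⟨P, h1.localInverse h2 (by simp), hP, ?_, ?_⟩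
  · exact (h1.to_localInverse h2 (by simp)).comp (θ q₀) P.contDiff.contDiffAt
  · exact (h1.hasStrictFDerivAt' h2 (by simp)).eventually_left_inverse

/-- The point of `D` with coordinates `q` in the chart `e` of `M ∩ D`. -/
def chartPoint (e : OpenPartialHomeomorph ↥(M ∩ (D : Set H)) (EuclideanSpace ℝ (Fin m)))
    (q : EuclideanSpace ℝ (Fin m)) : D := ⟨(e.symm q : H), (e.symm q).2.2⟩

variable {e : OpenPartialHomeomorph ↥(M ∩ (D : Set H)) (EuclideanSpace ℝ (Fin m))}

theorem chartPoint_mem (q : EuclideanSpace ℝ (Fin m)) : (chartPoint e q : H) ∈ M :=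
  (e.symm q).2.1

theorem continuousOn_chartPoint : ContinuousOn (chartPoint e) e.target := by
  rw [Topology.IsInducing.subtypeVal.continuousOn_iff]
  exact (continuous_subtype_val (p := (· ∈ M ∩ (D : Set H)))).comp_continuousOn
    e.continuousOn_symm

theorem IsSmoothChart.contDiffAt (he : IsSmoothChart e) {q : EuclideanSpace ℝ (Fin m)}
    (hq : q ∈ e.target) : ContDiffAt ℝ ∞ (fun v => (chartPoint e v : H)) q :=
  he.contDiffOn.contDiffAt (e.open_target.mem_nhds hq)

/-- The map `g ∘ P` is smooth on a neighbourhood in `H` and recovers chart coordinates on `M ∩ D`.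
It turns functions that are smooth in a chart into smooth functions of the ambient variable. -/
theorem exists_ambient_chart (hM : IsSubmanifold m (M ∩ (D : Set H))) {p : D} (hp : (p : H) ∈ M) :
    ∃ e : OpenPartialHomeomorph ↥(M ∩ (D : Set H)) (EuclideanSpace ℝ (Fin m)), IsSmoothChart e ∧
    ∃ (P : H →L[ℝ] EuclideanSpace ℝ (Fin m))
      (g : EuclideanSpace ℝ (Fin m) → EuclideanSpace ℝ (Fin m)),
      g (P p) ∈ e.target ∧ chartPoint e (g (P p)) = p ∧
      (∀ v, P (fderiv ℝ (fun v => (e.symm v : H)) (g (P p)) v) = v) ∧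
      ContDiffAt ℝ ∞ (fun y => g (P y)) (p : H) ∧
      ∀ᶠ y : D in 𝓝[states D M] p, chartPoint e (g (P y)) = y := by
  obtain ⟨e, hpe, he⟩ := hM ⟨p, hp, p.2⟩
  set p' : ↥(M ∩ (D : Set H)) := ⟨p, hp, p.2⟩
  have hq := e.map_source hpe
  obtain ⟨P, g, hP, hg, hev⟩ := exists_local_leftInverse (he.contDiffAt hq) (he.injective _ hq)
  have hpp : chartPoint e (e p') = p := Subtype.ext (by simp [chartPoint, e.left_inv hpe, p'])
  have h0 : g (P p) = e p' := by
    have := hev.self_of_nhds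
    rwa [hpp] at this
  refine ⟨e, he, P, g, by rwa [h0], by rw [h0, hpp], by rw [h0]; exact hP, by
    rw [hpp] at hg; exact hg, ?_⟩
  have h1 : ∀ᶠ y in 𝓝 p', y ∈ e.source ∧ g (P (chartPoint e (e y))) = e y :=
    Filter.Eventually.and (e.open_source.mem_nhds hpe) ((e.continuousAt hpe).eventually hev)
  obtain ⟨δ, hδ, h2⟩ := Metric.eventually_nhds_iff.1 h1
  rw [eventually_nhdsWithin_iff]
  filter_upwards [Metric.ball_mem_nhds p hδ] with y hy hyM
  obtain ⟨h3, h4⟩ := h2 (y := ⟨y, hyM, y.2⟩) hy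
  have h5 : chartPoint e (e ⟨y, hyM, y.2⟩) = y :=
    Subtype.ext (by simp [chartPoint, e.left_inv h3])
  rw [h5] at h4
  rw [h4, h5]

/-- A time-independent skew-Hermitian operator which is a smooth vector field on `M ∩ D`. -/
structure IsTangentField (m : ℕ) (M : Set H) (B : Module.End ℂ D) : Prop where
  skew : IsSkewHermitian B
  contDiffOn : ∀ e : OpenPartialHomeomorph ↥(M ∩ (D : Set H)) (EuclideanSpace ℝ (Fin m)),
    IsSmoothChart e → ContDiffOn ℝ ∞ (fun q => (B (chartPoint e q) : H)) e.target
  tangent : ∀ e : OpenPartialHomeomorph ↥(M ∩ (D : Set H)) (EuclideanSpace ℝ (Fin m)),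
    IsSmoothChart e → ∀ q ∈ e.target,
      (B (chartPoint e q) : H) ∈ Set.range (fderiv ℝ (fun w => (e.symm w : H)) q)

namespace IsTangentField

theorem zero : IsTangentField m M (0 : Module.End ℂ D) where
  skew := .zero
  contDiffOn _ _ := contDiffOn_const
  tangent _ _ _ _ := ⟨0, by simp⟩

theorem add {A B : Module.End ℂ D} (hA : IsTangentField m M A) (hB : IsTangentField m M B) :
    IsTangentField m M (A + B) where
  skew := hA.skew.add hB.skew
  contDiffOn e he := (hA.contDiffOn e he).add (hB.contDiffOn e he)
  tangent e he q hq := by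
    obtain ⟨a, ha⟩ := hA.tangent e he q hq
    obtain ⟨b, hb⟩ := hB.tangent e he q hq
    exact ⟨a + b, by rw [map_add, ha, hb]; rfl⟩

theorem smul {A : Module.End ℂ D} (hA : IsTangentField m M A) (c : ℝ) :
    IsTangentField m M (c • A) where
  skew := hA.skew.smul c
  contDiffOn e he := contDiffOn_const.smul (hA.contDiffOn e he)
  tangent e he q hq := by
    obtain ⟨a, ha⟩ := hA.tangent e he q hq
    exact ⟨c • a, by rw [map_smul, ha]; rfl⟩

/-- The coordinates are smooth because differentiating `g (P (chartPoint e q)) = q` expresses them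
locally as the derivative of `g ∘ P` applied to the smooth map `B (chartPoint e q)`. -/
theorem exists_coord {B : Module.End ℂ D} (hB : IsTangentField m M B) (he : IsSmoothChart e) :
    ∃ b : EuclideanSpace ℝ (Fin m) → EuclideanSpace ℝ (Fin m), ContDiffOn ℝ ∞ b e.target ∧
      ∀ q ∈ e.target, (B (chartPoint e q) : H) =
        fderiv ℝ (fun w => (chartPoint e w : H)) q (b q) := by
  classical
  have ht := hB.tangent e he
  choose! b hb using ht
  refine ⟨b, fun q₀ hq₀ => ContDiffAt.contDiffWithinAt ?_, fun q hq => (hb q hq).symm⟩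
  have hθ := he.contDiffAt hq₀
  obtain ⟨P, g, -, hg, hev⟩ := exists_local_leftInverse hθ (he.injective _ hq₀)
  have hBc : ContDiffAt ℝ ∞ (fun q => (B (chartPoint e q) : H)) q₀ :=
    (hB.contDiffOn e he).contDiffAt (e.open_target.mem_nhds hq₀)
  have h1 : ContDiffAt ℝ ∞ (fun q => fderiv ℝ (fun y => g (P y)) (chartPoint e q : H)) q₀ :=
    ContDiffAt.comp q₀ (g := fderiv ℝ (fun y => g (P y))) (hg.fderiv_right (m := ∞) (by simp)) hθ
  refine (h1.clm_apply hBc).congr_of_eventuallyEq ?_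
  have h2 : ∀ᶠ y in 𝓝 (chartPoint e q₀ : H), ContDiffAt ℝ 1 (fun y => g (P y)) y :=
    (hg.of_le (by simp)).eventually (by simp)
  filter_upwards [e.open_target.mem_nhds hq₀, hθ.continuousAt.eventually h2,
    hev.eventually_nhds] with q hq hgq hid
  rw [← hb q hq]
  have h3 : HasFDerivAt (fun q => g (P (chartPoint e q : H)))
      ((fderiv ℝ (fun y => g (P y)) (chartPoint e q : H)).comp
        (fderiv ℝ (fun w => (chartPoint e w : H)) q)) q :=
    HasFDerivAt.comp (g := fun y => g (P y)) q (hgq.differentiableAt (by simp)).hasFDerivAt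
      ((he.contDiffAt hq).differentiableAt (by simp)).hasFDerivAt
  have h4 := h3.unique ((hasFDerivAt_id q).congr_of_eventuallyEq hid)
  exact (congrArg (fun f => f (b q)) h4).symm

/-- Applying a tangent field `A` to a tangent vector field amounts to differentiating `A` in its
direction. -/
theorem apply_fderiv {A : Module.End ℂ D} (hA : IsTangentField m M A) (hD : Dense (D : Set H))
    (he : IsSmoothChart e) {q v : EuclideanSpace ℝ (Fin m)} (hq : q ∈ e.target) {x : D}
    (hx : (x : H) = fderiv ℝ (fun w => (chartPoint e w : H)) q v) :
    (A x : H) = fderiv ℝ (fun w => (A (chartPoint e w) : H)) q v := by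
  have hline : HasDerivAt (fun s : ℝ => q + s • v) v 0 := by
    simpa using ((hasDerivAt_id (0 : ℝ)).smul_const v).const_add q
  have h0 : q + (0 : ℝ) • v = q := by simp
  refine hA.skew.apply_eq_of_hasDerivAt hD (f := fun s => chartPoint e (q + s • v)) (t := 0) ?_ ?_
  · rw [hx]
    have h1 := ((he.contDiffAt hq).differentiableAt (by simp)).hasFDerivAt
    exact h1.comp_hasDerivAt_of_eq 0 hline h0.symm
  · have h1 := (((hA.contDiffOn e he).contDiffAt (e.open_target.mem_nhds hq)).differentiableAt
      (by simp)).hasFDerivAt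
    exact h1.comp_hasDerivAt_of_eq 0 hline h0.symm

/-- By closability `A (B ψ)` is the derivative of `A` along the field of `B`. In a chart the
difference of the two such derivatives loses its second-order terms by symmetry of the second
derivative. What is left is the chart differential applied to `Da b - Db a`, which is tangent and
smooth. -/
theorem lie {A B : Module.End ℂ D} (hA : IsTangentField m M A) (hB : IsTangentField m M B)
    (hD : Dense (D : Set H)) : IsTangentField m M ⁅A, B⁆ := by
  have key : ∀ e : OpenPartialHomeomorph ↥(M ∩ (D : Set H)) (EuclideanSpace ℝ (Fin m)),
      IsSmoothChart e → ∀ a b : EuclideanSpace ℝ (Fin m) → EuclideanSpace ℝ (Fin m),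
      (∀ q ∈ e.target, (A (chartPoint e q) : H) =
        fderiv ℝ (fun w => (chartPoint e w : H)) q (a q)) →
      (∀ q ∈ e.target, (B (chartPoint e q) : H) =
        fderiv ℝ (fun w => (chartPoint e w : H)) q (b q)) → ∀ q ∈ e.target,
      (⁅A, B⁆ (chartPoint e q) : H) = fderiv ℝ (fun w => (A (chartPoint e w) : H)) q (b q) -
        fderiv ℝ (fun w => (B (chartPoint e w) : H)) q (a q) := by
    intro e he a b ha hb q hq
    rw [← hA.apply_fderiv hD he hq (hb q hq), ← hB.apply_fderiv hD he hq (ha q hq)]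
    rfl
  have hdiff : ∀ {C : Module.End ℂ D}
      (e : OpenPartialHomeomorph ↥(M ∩ (D : Set H)) (EuclideanSpace ℝ (Fin m)))
      (_ : IsSmoothChart e) (c : EuclideanSpace ℝ (Fin m) → EuclideanSpace ℝ (Fin m))
      (_ : ContDiffOn ℝ ∞ c e.target)
      (_ : ∀ q ∈ e.target, (C (chartPoint e q) : H) =
        fderiv ℝ (fun w => (chartPoint e w : H)) q (c q)) (q) (_ : q ∈ e.target) (v),
      fderiv ℝ (fun w => (C (chartPoint e w) : H)) q v =
        fderiv ℝ (fun w => (chartPoint e w : H)) q (fderiv ℝ c q v) +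
        fderiv ℝ (fderiv ℝ (fun w => (chartPoint e w : H))) q v (c q) := by
    intro C e he c hc hCc q hq v
    have hev : (fun w => (C (chartPoint e w) : H)) =ᶠ[𝓝 q]
        fun q => fderiv ℝ (fun w => (chartPoint e w : H)) q (c q) := by
      filter_upwards [e.open_target.mem_nhds hq] with w hw using hCc w hw
    have h1 : DifferentiableAt ℝ (fderiv ℝ (fun w => (chartPoint e w : H))) q :=
      ((he.contDiffAt hq).fderiv_right (m := ∞) (by simp)).differentiableAt (by simp)
    have h2 : DifferentiableAt ℝ c q :=
      (hc.contDiffAt (e.open_target.mem_nhds hq)).differentiableAt (by simp)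
    rw [hev.fderiv_eq, (h1.hasFDerivAt.clm_apply h2.hasFDerivAt).fderiv]
    simp
  refine ⟨hA.skew.lie hB.skew, fun e he => ?_, fun e he q hq => ?_⟩
  · obtain ⟨a, ha, hAa⟩ := hA.exists_coord he
    obtain ⟨b, hb, hBb⟩ := hB.exists_coord he
    refine ContDiffOn.congr ?_ (key e he a b hAa hBb)
    exact (((hA.contDiffOn e he).fderiv_of_isOpen e.open_target (by simp)).clm_apply hb).sub
      (((hB.contDiffOn e he).fderiv_of_isOpen e.open_target (by simp)).clm_apply ha)
  · obtain ⟨a, ha, hAa⟩ := hA.exists_coord he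
    obtain ⟨b, hb, hBb⟩ := hB.exists_coord he
    refine ⟨fderiv ℝ a q (b q) - fderiv ℝ b q (a q), ?_⟩
    have hsymm := ((he.contDiffAt hq).isSymmSndFDerivAt (by
      rw [minSmoothness_of_isRCLikeNormedField]; exact WithTop.coe_le_coe.2 (le_top : (2 : ℕ∞) ≤ ⊤)))
      (a q) (b q)
    rw [key e he a b hAa hBb q hq, hdiff e he a ha hAa q hq, hdiff e he b hb hBb q hq, hsymm,
      map_sub]
    change _ = _ + _ - (_ + _)
    rw [add_sub_add_right_eq_sub]
    rfl

theorem of_mem_lieSpan (hD : Dense (D : Set H)) {s : Set (Module.End ℂ D)}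
    (hs : ∀ A ∈ s, IsTangentField m M A) {B : Module.End ℂ D}
    (hB : B ∈ LieSubalgebra.lieSpan ℝ _ s) : IsTangentField m M B := by
  induction hB using LieSubalgebra.lieSpan_induction with
  | mem x hx => exact hs x hx
  | zero => exact .zero
  | add x y _ _ hx hy => exact hx.add hy
  | smul c x _ hx => exact hx.smul c
  | lie x y _ _ hx hy => exact hx.lie hy hD

/-- If `B` is a tangent field and `z` is a differentiable curve in `M ∩ D`, then
`(B z)' = B z'`. -/
theorem hasDerivAt {B : Module.End ℂ D} (hB : IsTangentField m M B) (hD : Dense (D : Set H))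
    (hM : IsSubmanifold m (M ∩ (D : Set H))) {z : ℝ → D} {z' : D} {t : ℝ}
    (hzM : ∀ s, (z s : H) ∈ M) (hz : HasDerivAt z z' t) :
    HasDerivAt (fun s => B (z s)) (B z') t := by
  obtain ⟨e, he, P, g, hqt, hpt, -, hg, hev⟩ := exists_ambient_chart hM (hzM t)
  have hev' : ∀ᶠ s in 𝓝 t, chartPoint e (g (P (z s))) = z s :=
    (tendsto_nhdsWithin_iff.2 ⟨hz.continuousAt, Filter.Eventually.of_forall hzM⟩).eventually hev
  have hz' := hasDerivAt_coe_iff.2 hz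
  have h1 := (hg.differentiableAt (by simp)).hasFDerivAt.comp_hasDerivAt t hz'
  have h2 := (((hB.contDiffOn e he).contDiffAt (e.open_target.mem_nhds hqt)).differentiableAt
      (by simp)).hasFDerivAt.comp_hasDerivAt t h1
  have h3 := h2.congr_of_eventuallyEq (f₁ := fun s => (B (z s) : H)) (by
    filter_upwards [hev'] with s hs
    simp [hs])
  rw [← hasDerivAt_coe_iff, hB.skew.apply_eq_of_hasDerivAt hD hz' h3]
  exact h3

end IsTangentField

theorem IsSmoothVectorField.isTangentField {t₀ t : ℝ} {A : ℝ → Module.End ℂ D}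
    (hA : IsSmoothVectorField m M t₀ A) (ht : t₀ ≤ t) (hs : IsSkewHermitian (A t)) :
    IsTangentField m M (A t) where
  skew := hs
  contDiffOn e he := (hA.contDiffOn e he).comp (f := fun q => (t, q))
    (contDiff_const.prodMk contDiff_id).contDiffOn fun _ hq => ⟨ht, hq⟩
  tangent e he q hq := hA.tangent e he t ht q hq

/-- A smooth time-dependent vector field on `M ∩ D` extends to a smooth function of time and of the
ambient variable. -/
theorem IsSmoothVectorField.exists_ambient {t₀ t : ℝ} {A : ℝ → Module.End ℂ D}
    (hA : IsSmoothVectorField m M t₀ A) (hM : IsSubmanifold m (M ∩ (D : Set H))) (ht : t₀ < t)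
    {p : D} (hp : (p : H) ∈ M) :
    ∃ X : ℝ × H → H, ContDiffAt ℝ ∞ X (t, p) ∧
      ∀ᶠ y : D in 𝓝[states D M] p, ∀ s, (A s y : H) = X (s, y) := by
  obtain ⟨e, he, P, g, hqt, hpt, -, hg, hev⟩ := exists_ambient_chart hM hp
  refine ⟨fun q => (A q.1 (chartPoint e (g (P q.2))) : H), ?_, ?_⟩
  · have h1 := (hA.contDiffOn e he).contDiffAt
      (prod_mem_nhds (Ici_mem_nhds ht) (e.open_target.mem_nhds hqt))
    have h2 : ContDiffAt ℝ ∞ (fun q : ℝ × H => (q.1, g (P q.2))) (t, (p : H)) :=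
      contDiffAt_fst.prodMk (ContDiffAt.comp (g := fun y => g (P y)) (t, (p : H)) hg contDiffAt_snd)
    exact ContDiffAt.comp (g := fun q : ℝ × EuclideanSpace ℝ (Fin m) =>
      (A q.1 (chartPoint e q.2) : H)) (t, (p : H)) h1 h2
  · filter_upwards [hev] with y hy s
    simp [hy]

/-- Local compactness of `M ∩ D`, from closed balls in chart coordinates. -/
theorem exists_compact_nhdsWithin (hM : IsSubmanifold m (M ∩ (D : Set H))) {p : D}
    (hp : (p : H) ∈ M) :
    ∃ C : Set D, IsCompact C ∧ (∀ y ∈ C, (y : H) ∈ M) ∧ C ∈ 𝓝[states D M] p := by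
  obtain ⟨e, he, P, g, hqt, hpt, -, hg, hev⟩ := exists_ambient_chart hM hp
  obtain ⟨r, hr, hrt⟩ := Metric.nhds_basis_closedBall.mem_iff.1 (e.open_target.mem_nhds hqt)
  refine ⟨chartPoint e '' Metric.closedBall (g (P p)) r,
    (isCompact_closedBall _ _).image_of_continuousOn (continuousOn_chartPoint.mono hrt),
    ?_, ?_⟩
  · rintro _ ⟨q, -, rfl⟩
    exact chartPoint_mem q
  · have h1 : ∀ᶠ y : D in 𝓝 p, g (P y) ∈ Metric.closedBall (g (P p)) r :=
      (hg.continuousAt.comp (f := fun y : D => (y : H))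
        continuous_subtype_val.continuousAt).eventually (Metric.closedBall_mem_nhds _ hr)
    filter_upwards [hev, nhdsWithin_le_nhds h1] with y hy hy1
    exact ⟨_, hy1, hy⟩

end Charts

/-! ### An induction principle for generated Lie algebras. -/

section LieSpan

/-- A subspace which contains `s` and is stable under bracketing with elements of `s` contains the
Lie algebra generated by `s`. -/
theorem lieSpan_le_of_lie_mem {R L : Type*} [CommRing R] [LieRing L] [LieAlgebra R L] {s : Set L}
    (N : Submodule R L) (hs : s ⊆ N) (h : ∀ a ∈ s, ∀ y ∈ N, ⁅a, y⁆ ∈ N) {x : L}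
    (hx : x ∈ LieSubalgebra.lieSpan R L s) : x ∈ N := by
  -- `N` need not be a subalgebra. By the Jacobi identity, however, the elements whose adjoint
  -- action preserves `N` are closed under brackets, so stability passes from `s` to the whole Lie
  -- algebra.
  have had : ∀ x ∈ LieSubalgebra.lieSpan R L s, ∀ y ∈ N, ⁅x, y⁆ ∈ N := by
    intro x hx
    induction hx using LieSubalgebra.lieSpan_induction with
    | mem x hx => exact h x hx
    | zero => intro y _; simp
    | add x x' _ _ hx hx' => intro y hy; rw [add_lie]; exact N.add_mem (hx y hy) (hx' y hy)
    | smul c x _ hx => intro y hy; rw [smul_lie]; exact N.smul_mem c (hx y hy)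
    | lie x x' _ _ hx hx' =>
      intro y hy
      rw [lie_lie]
      exact N.sub_mem (hx _ (hx' y hy)) (hx' _ (hx y hy))
  induction hx using LieSubalgebra.lieSpan_induction with
  | mem x hx => exact hs hx
  | zero => exact N.zero_mem
  | add x x' _ _ hx hx' => exact N.add_mem hx hx'
  | smul c x _ hx => exact N.smul_mem c hx
  | lie x x' hx _ _ hx' => exact had x hx x' hx'

end LieSpan

/-! ### Words of flows and the fields transported along them. -/

section FlowWords

variable {H : Type*} [NormedAddCommGroup H] [InnerProductSpace ℂ H] {D : Submodule ℂ H}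
  {m r : ℕ} {M : Set H}

/-- The composition of flows prescribed by a list of letters, the head being applied first. -/
def flowWord (U : Fin r → ℝ → (D ≃ₗᵢ[ℂ] D)) : List (Fin r × ℝ) → (D ≃ₗᵢ[ℂ] D)
  | [] => LinearIsometryEquiv.refl ℂ D
  | p :: w => (U p.1 p.2).trans (flowWord U w)

/-- The word `w`, whose exponents are functions of a parameter, at the parameter `θ`. -/
def evalWord {Θ : Type*} (w : List (Fin r × (Θ → ℝ))) (θ : Θ) : List (Fin r × ℝ) :=
  w.map fun p => (p.1, p.2 θ)

/-- A word with exponents not depending on the parameter. -/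
def constWord (Θ : Type*) (w : List (Fin r × ℝ)) : List (Fin r × (Θ → ℝ)) :=
  w.map fun p => (p.1, fun _ => p.2)

@[simp] theorem evalWord_constWord {Θ : Type*} (w : List (Fin r × ℝ)) (θ : Θ) :
    evalWord (constWord Θ w) θ = w := by
  simp [evalWord, constWord, Function.comp_def]

@[simp] theorem evalWord_append {Θ : Type*} (v w : List (Fin r × (Θ → ℝ))) (θ : Θ) :
    evalWord (v ++ w) θ = evalWord v θ ++ evalWord w θ := by
  simp [evalWord]

section Basic

variable {U : Fin r → ℝ → (D ≃ₗᵢ[ℂ] D)}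

@[simp] theorem flowWord_nil (x : D) : flowWord U [] x = x := rfl

@[simp] theorem flowWord_cons (p : Fin r × ℝ) (w : List (Fin r × ℝ)) (x : D) :
    flowWord U (p :: w) x = flowWord U w (U p.1 p.2 x) := rfl

@[simp] theorem flowWord_append (v w : List (Fin r × ℝ)) (x : D) :
    flowWord U (v ++ w) x = flowWord U w (flowWord U v x) := by
  induction v generalizing x with
  | nil => rfl
  | cons p v ih => simp [ih]

end Basic

/-- Tangent fields `A l` with flows `U l` that preserve `M ∩ D`. -/
structure IsFlowSystem (m : ℕ) (M : Set H) (A : Fin r → Module.End ℂ D)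
    (U : Fin r → ℝ → (D ≃ₗᵢ[ℂ] D)) : Prop where
  isFlow : ∀ l, IsFlow (A l) (U l)
  tangent : ∀ l, IsTangentField m M (A l)
  mapsTo : ∀ l t, ∀ x ∈ states D M, U l t x ∈ states D M

theorem IsFlow.conj {A : Module.End ℂ D} {U : ℝ → (D ≃ₗᵢ[ℂ] D)} (h : IsFlow A U)
    (V : D ≃ₗᵢ[ℂ] D) :
    IsFlow ((V : D →ₗ[ℂ] D) ∘ₗ A ∘ₗ (V.symm : D →ₗ[ℂ] D))
      fun t => (V.symm.trans (U t)).trans V where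
  map_add s t x := by simp [h.map_add]
  hasDerivAt x t := by
    have := IsFlow.hasDerivAt_comp_isometry V (h.hasDerivAt (V.symm x) t)
    simpa using this

/-- A product rule for a strongly continuous group with unbounded generator: joint continuity of the
flow replaces differentiability in operator norm. -/
theorem IsFlow.hasDerivAt_apply {A : Module.End ℂ D} {U : ℝ → (D ≃ₗᵢ[ℂ] D)} (h : IsFlow A U)
    {b : ℝ → D} {b' : D} (hb : HasDerivAt b b' 0) :
    HasDerivAt (fun t => U t (b t)) (A (b 0) + b') 0 := by
  have h1 : HasDerivAt (fun t => U t (b t - b 0)) b' 0 := by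
    rw [hasDerivAt_iff_tendsto_slope] at hb ⊢
    have h2 : Filter.Tendsto (fun t : ℝ => (t, slope b 0 t)) (𝓝[≠] 0) (𝓝 (0, b')) :=
      (tendsto_nhdsWithin_of_tendsto_nhds Filter.tendsto_id).prodMk_nhds hb
    have h3 := (h.continuous_uncurry.tendsto (0, b')).comp h2
    rw [h.map_zero] at h3
    refine h3.congr fun t => ?_
    have : U t ((t - 0)⁻¹ • (b t - b 0)) = (t - 0)⁻¹ • U t (b t - b 0) :=
      LinearMap.map_smul_of_tower (U t : D →ₗ[ℂ] D) _ _
    simp only [Function.comp, slope_def_module]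
    rw [this]
    simp
  have h4 := (h.hasDerivAt (b 0) 0).add h1
  rw [h.map_zero] at h4
  refine h4.congr_of_eventuallyEq (Filter.Eventually.of_forall fun t => ?_)
  simp

theorem Submodule.mem_of_hasDerivAt {E : Type*} [NormedAddCommGroup E] [NormedSpace ℝ E]
    [FiniteDimensional ℝ E] (Q : Submodule ℝ E) {f : ℝ → E} {f' : E} {t : ℝ}
    (hf : HasDerivAt f f' t) (hQ : ∀ s, f s ∈ Q) : f' ∈ Q := by
  rw [hasDerivAt_iff_tendsto_slope] at hf
  refine Q.closed_of_finiteDimensional.mem_of_tendsto hf (Filter.Eventually.of_forall fun s => ?_)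
  rw [slope_def_module]
  exact Q.smul_mem _ (Q.sub_mem (hQ s) (hQ t))

namespace IsFlowSystem

variable {A : Fin r → Module.End ℂ D} {U : Fin r → ℝ → (D ≃ₗᵢ[ℂ] D)}

theorem flowWord_mem (h : IsFlowSystem m M A U) (w : List (Fin r × ℝ)) {x : D}
    (hx : x ∈ states D M) : flowWord U w x ∈ states D M := by
  induction w generalizing x with
  | nil => exact hx
  | cons p w ih => exact ih (h.mapsTo _ _ x hx)

theorem exists_inv (h : IsFlowSystem m M A U) (w : List (Fin r × ℝ)) :
    ∃ w', ∀ x, flowWord U w' x = (flowWord U w).symm x := by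
  induction w with
  | nil => exact ⟨[], fun x => rfl⟩
  | cons p w ih =>
    obtain ⟨w', hw'⟩ := ih
    refine ⟨w' ++ [(p.1, -p.2)], fun x => ?_⟩
    rw [flowWord_append, hw', LinearIsometryEquiv.eq_symm_apply]
    simp [(h.isFlow p.1).apply_neg]

theorem symm_mem (h : IsFlowSystem m M A U) (w : List (Fin r × ℝ)) {x : D}
    (hx : x ∈ states D M) : (flowWord U w).symm x ∈ states D M := by
  obtain ⟨w', hw'⟩ := h.exists_inv w
  rw [← hw']
  exact h.flowWord_mem w' hx

/-- The vector fields obtained by transporting the generators along words of flows span, at a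
point `x`, a space which contains the values of all elements of the generated Lie algebra. -/
theorem lieSpan_apply_mem (h : IsFlowSystem m M A U) (hD : Dense (D : Set H))
    (hM : IsSubmanifold m (M ∩ (D : Set H))) {E : Type*} [NormedAddCommGroup E]
    [NormedSpace ℝ E] [FiniteDimensional ℝ E] (P : D →L[ℝ] E) {x : D} (hx : x ∈ states D M)
    {B : Module.End ℂ D} (hB : B ∈ LieSubalgebra.lieSpan ℝ _ (Set.range A)) :
    P (B x) ∈ Submodule.span ℝ
      (Set.range fun p : List (Fin r × ℝ) × Fin r =>
        P (flowWord U p.1 (A p.2 ((flowWord U p.1).symm x)))) := by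
  set Q := Submodule.span ℝ (Set.range fun p : List (Fin r × ℝ) × Fin r =>
        P (flowWord U p.1 (A p.2 ((flowWord U p.1).symm x)))) with hQ
  -- Quantifying over all words lets a letter `(l, t)` be put in front of `w`, so that membership in
  -- `Q` can be differentiated in `t`.
  let N : Submodule ℝ (Module.End ℂ D) :=
    { carrier := {B | IsTangentField m M B ∧
        ∀ w, P (flowWord U w (B ((flowWord U w).symm x))) ∈ Q}
      add_mem' := fun {B C} hB hC => ⟨hB.1.add hC.1, fun w => by
        simpa using Q.add_mem (hB.2 w) (hC.2 w)⟩
      zero_mem' := ⟨.zero, fun w => by simp⟩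
      smul_mem' := fun c B hB => ⟨hB.1.smul c, fun w => by
        have h1 : flowWord U w ((c • B) ((flowWord U w).symm x)) =
            c • flowWord U w (B ((flowWord U w).symm x)) := by
          rw [LinearMap.smul_apply]
          exact LinearMap.map_smul_of_tower (flowWord U w : D →ₗ[ℂ] D) _ _
        rw [h1, map_smul]
        exact Q.smul_mem c (hB.2 w)⟩ }
  have hN : B ∈ N := by
    refine lieSpan_le_of_lie_mem N ?_ ?_ hB
    · rintro _ ⟨l, rfl⟩
      exact ⟨h.tangent l, fun w => Submodule.subset_span ⟨(w, l), rfl⟩⟩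
    · rintro _ ⟨l, rfl⟩ C ⟨hC, hCQ⟩
      refine ⟨(h.tangent l).lie hC hD, fun w => ?_⟩
      set z := (flowWord U w).symm x
      have hz : z ∈ states D M := h.symm_mem w hx
      have hflow := h.isFlow l
      have h1 : HasDerivAt (fun t => U l (-t) z) (-(A l z)) 0 := by
        have h2 := hflow.hasDerivAt z (-0)
        rw [neg_zero, hflow.map_zero, ← neg_zero] at h2
        have h3 := HasDerivAt.scomp (0 : ℝ) h2 (hasDerivAt_neg (0 : ℝ))
        simpa [Function.comp_def] using h3
      have h2 := hC.hasDerivAt hD hM (fun t => h.mapsTo l (-t) z hz) h1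
      -- At `t = 0` the derivative of `U l t (C (U l (-t) z))` is `⁅A l, C⁆ z`. The image under `P`
      -- lies in a finite-dimensional, hence closed, space `Q`, so the derivative stays in it.
      have h3 := hflow.hasDerivAt_apply h2
      have h4 := P.hasFDerivAt.comp_hasDerivAt (0 : ℝ)
        (IsFlow.hasDerivAt_comp_isometry (flowWord U w) h3)
      have h5 := Submodule.mem_of_hasDerivAt Q h4 fun t => by
        have h6 := hCQ ((l, t) :: w)
        have h7 : (flowWord U ((l, t) :: w)).symm x = U l (-t) z := by
          rw [LinearIsometryEquiv.symm_apply_eq]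
          simp [hflow.apply_neg, z]
        rw [h7] at h6
        exact h6
      have h8 : A l (C (U l (-0) z)) + C (-(A l z)) = ⁅A l, C⁆ z := by
        rw [neg_zero, hflow.map_zero, map_neg, ← sub_eq_add_neg]
        rfl
      rwa [h8] at h5
  exact hN.2 []

end IsFlowSystem

/-- Composition of a strictly differentiable family of points of `M ∩ D` with a flow. -/
theorem IsFlow.hasStrictFDerivAt {C : Module.End ℂ D} {W : ℝ → (D ≃ₗᵢ[ℂ] D)} (h : IsFlow C W)
    (hW : ∀ t, ∀ x ∈ states D M, W t x ∈ states D M) {x : D}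
    (hC : ContinuousWithinAt C (states D M) x) {Θ : Type*} [NormedAddCommGroup Θ]
    [NormedSpace ℝ Θ] [FiniteDimensional ℝ Θ] {f : Θ → D} {L : Θ →L[ℝ] D}
    (hf : HasStrictFDerivAt f L 0) (hfM : ∀ θ, f θ ∈ states D M) (hf0 : f 0 = x)
    (g : Θ →L[ℝ] ℝ) :
    HasStrictFDerivAt (fun θ => W (g θ) (f θ)) (L + g.smulRight (C x)) 0 := by
  refine HasStrictFDerivAt.of_isLittleO ?_
  -- Three errors: that of `f`, carried by an isometry; `W t ∘ L - L`, small in operator norm since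
  -- `Θ` is finite-dimensional; and the motion along the flow, handled by the mean value inequality
  -- and continuity of `C` on `M ∩ D` at `x`.
  have hsplit : ∀ p : Θ × Θ, W (g p.1) (f p.1) - W (g p.2) (f p.2) -
      (L + g.smulRight (C x)) (p.1 - p.2) =
      W (g p.1) (f p.1 - f p.2 - L (p.1 - p.2)) + (W (g p.1) (L (p.1 - p.2)) - L (p.1 - p.2)) +
        (W (g p.1) (f p.2) - W (g p.2) (f p.2) - (g p.1 - g p.2) • C x) := by
    intro p
    simp only [map_sub, _root_.add_apply, ContinuousLinearMap.smulRight_apply, sub_smul]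
    abel
  simp only [hsplit]
  have hfst : Filter.Tendsto (fun p : Θ × Θ => g p.1) (𝓝 (0, 0)) (𝓝 0) := by
    have : Continuous fun p : Θ × Θ => g p.1 := by fun_prop
    simpa using this.tendsto (0, 0)
  have hsnd : Filter.Tendsto (fun p : Θ × Θ => g p.2) (𝓝 (0, 0)) (𝓝 0) := by
    have : Continuous fun p : Θ × Θ => g p.2 := by fun_prop
    simpa using this.tendsto (0, 0)
  refine (Asymptotics.IsLittleO.add ?_ ?_).add ?_
  · refine (Asymptotics.isLittleO_norm_left.1 ?_)
    simp only [LinearIsometryEquiv.norm_map]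
    exact Asymptotics.isLittleO_norm_left.2 hf.isLittleO
  · let T : ℝ → Θ →L[ℝ] D := fun t =>
      ((W t).toContinuousLinearEquiv : D →L[ℂ] D).restrictScalars ℝ ∘L L - L
    have hT : Continuous T := by
      rw [continuous_clm_apply]
      intro v
      exact (h.continuous_uncurry.comp (continuous_id.prodMk continuous_const)).sub
        continuous_const
    have hT0 : T 0 = 0 := by
      ext v
      simp [T, h.map_zero]
    have hT0' : ‖T 0‖ = 0 := by
      rw [hT0]
      exact norm_zero (E := Θ →L[ℝ] D)
    have h1 : Filter.Tendsto (fun p : Θ × Θ => ‖T (g p.1)‖) (𝓝 (0, 0)) (𝓝 0) := by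
      have := (((continuous_norm (E := Θ →L[ℝ] D)).comp hT).tendsto 0).comp hfst
      simp only [Function.comp_def, hT0'] at this
      exact this
    rw [Asymptotics.isLittleO_iff]
    intro ε hε
    filter_upwards [h1.eventually (gt_mem_nhds hε)] with p hp
    calc ‖W (g p.1) (L (p.1 - p.2)) - L (p.1 - p.2)‖ = ‖T (g p.1) (p.1 - p.2)‖ := rfl
      _ ≤ ‖T (g p.1)‖ * ‖p.1 - p.2‖ := (T (g p.1)).le_opNorm _
      _ ≤ ε * ‖p.1 - p.2‖ := mul_le_mul_of_nonneg_right hp.le (norm_nonneg _)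
  · have hg : (fun p : Θ × Θ => g p.1 - g p.2) =O[𝓝 (0, 0)] fun p => p.1 - p.2 := by
      simp only [← map_sub]
      exact g.isBigO_comp _ _
    refine Asymptotics.IsLittleO.trans_isBigO ?_ hg
    rw [Asymptotics.isLittleO_iff]
    intro ε hε
    have h1 : Filter.Tendsto (fun q : ℝ × D => C (W q.1 q.2)) (𝓝 0 ×ˢ 𝓝[states D M] x)
        (𝓝 (C x)) := by
      refine Filter.Tendsto.comp hC (tendsto_nhdsWithin_iff.2 ⟨?_, ?_⟩)
      · have h2 := h.continuous_uncurry.tendsto (0, x)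
        rw [h.map_zero, nhds_prod_eq] at h2
        exact h2.mono_left (Filter.prod_mono le_rfl nhdsWithin_le_nhds)
      · have h3 : ∀ᶠ q : ℝ × D in 𝓝 0 ×ˢ 𝓝[states D M] x, q.2 ∈ states D M :=
          Filter.tendsto_snd.eventually self_mem_nhdsWithin
        filter_upwards [h3] with q hq using hW _ _ hq
    have h2 := h1.eventually (Metric.closedBall_mem_nhds (C x) hε)
    obtain ⟨pa, hpa, pb, hpb, hab⟩ := Filter.eventually_prod_iff.1 h2
    obtain ⟨δ, hδ, hball⟩ := Metric.eventually_nhds_iff_ball.1 hpa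
    have hf2 : Filter.Tendsto (fun p : Θ × Θ => f p.2) (𝓝 (0, 0)) (𝓝[states D M] x) := by
      refine tendsto_nhdsWithin_iff.2 ⟨?_, Filter.Eventually.of_forall fun p => hfM _⟩
      have := hf.continuousAt.tendsto
      rw [hf0] at this
      exact this.comp (continuous_snd.tendsto' (0, 0) 0 rfl)
    filter_upwards [hfst.eventually (Metric.ball_mem_nhds 0 hδ),
      hsnd.eventually (Metric.ball_mem_nhds 0 hδ), hf2.eventually hpb] with p hp1 hp2 hp3
    have h5 := (convex_ball (0 : ℝ) δ).norm_image_sub_le_of_norm_hasDerivWithin_le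
      (f := fun s => W s (f p.2) - s • C x) (f' := fun s => C (W s (f p.2)) - C x) (C := ε)
      (fun s _ => by
        have := (h.hasDerivAt (f p.2) s).sub ((hasDerivAt_id s).smul_const (C x))
        rw [one_smul] at this
        exact this.hasDerivWithinAt)
      (fun s hs => by
        rw [← dist_eq_norm]
        exact hab (hball s hs) hp3) hp2 hp1
    refine le_trans (le_of_eq ?_) h5
    congr 1
    rw [sub_smul]
    abel

end FlowWords

/-! ### Orbit theorem: submersive words and transitivity. -/

section Orbits

variable {H : Type*} [NormedAddCommGroup H] [InnerProductSpace ℂ H] {D : Submodule ℂ H}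
  {m r : ℕ} {M : Set H}

theorem IsTangentField.continuousWithinAt {B : Module.End ℂ D} (hB : IsTangentField m M B)
    (hM : IsSubmanifold m (M ∩ (D : Set H))) {x : D} (hx : x ∈ states D M) :
    ContinuousWithinAt B (states D M) x := by
  obtain ⟨e, he, P, g, hqt, hpt, -, hg, hev⟩ := exists_ambient_chart hM hx
  rw [Topology.IsInducing.subtypeVal.continuousWithinAt_iff]
  have h1 : ContinuousAt (fun q => (B (chartPoint e q) : H)) (g (P x)) :=
    (hB.contDiffOn e he).continuousOn.continuousAt (e.open_target.mem_nhds hqt)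
  have h2 : ContinuousAt (fun y : D => g (P y)) x :=
    hg.continuousAt.comp (f := fun y : D => (y : H)) continuous_subtype_val.continuousAt
  have h3 : ContinuousAt (fun y : D => (B (chartPoint e (g (P y))) : H)) x :=
    ContinuousAt.comp (f := fun y : D => g (P y)) h1 h2
  refine h3.continuousWithinAt.congr_of_eventuallyEq ?_ ?_
  · filter_upwards [hev] with y hy
    simp [hy]
  · simp [hpt]

/-- Near each of its points, `M ∩ D` is mapped injectively to `ℝᵐ` by a linear map which is
injective on the tangent vectors. -/
theorem exists_linear_coord (hM : IsSubmanifold m (M ∩ (D : Set H))) {x : D}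
    (hx : x ∈ states D M) :
    ∃ P : D →L[ℝ] EuclideanSpace ℝ (Fin m), (∃ s ∈ 𝓝[states D M] x, Set.InjOn P s) ∧
      ∀ B : Module.End ℂ D, IsTangentField m M B → P (B x) = 0 → B x = 0 := by
  obtain ⟨e, he, P, g, hqt, hpt, hP, hg, hev⟩ := exists_ambient_chart hM hx
  refine ⟨P.comp ((D.subtypeL).restrictScalars ℝ), ⟨_, hev, fun y hy z hz hyz => ?_⟩,
    fun B hB h0 => ?_⟩
  · simp only [Set.mem_ofPred_eq] at hy hz
    rw [← hy, ← hz]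
    exact congrArg (fun q => chartPoint e (g q)) hyz
  · obtain ⟨v, hv⟩ := hB.tangent e he _ hqt
    rw [hpt] at hv
    have h1 : P (B x : H) = 0 := h0
    rw [← hv, hP] at h1
    rw [h1, map_zero] at hv
    exact Subtype.ext hv.symm

namespace IsFlowSystem

variable {A : Fin r → Module.End ℂ D} {U : Fin r → ℝ → (D ≃ₗᵢ[ℂ] D)}

/-- Each new block is a flow conjugated by a constant word, run for the time `θ i`. It is the
identity at `θ i = 0`, so every block is differentiated at the same point `x` and the derivatives
simply add. Exponents are constants or coordinates, hence Lipschitz, as the pulse estimates require.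
-/
theorem exists_word (h : IsFlowSystem m M A U) (hM : IsSubmanifold m (M ∩ (D : Set H)))
    {x : D} (hx : x ∈ states D M) {n : ℕ} (c : Fin n → List (Fin r × ℝ) × Fin r)
    (I : List (Fin n)) :
    ∃ w : List (Fin r × ((Fin n → ℝ) → ℝ)), (∀ p ∈ w, ∃ K, LipschitzWith K p.2) ∧
      flowWord U (evalWord w 0) x = x ∧
      HasStrictFDerivAt (fun θ => flowWord U (evalWord w θ) x)
        (I.map fun i => (ContinuousLinearMap.proj i : (Fin n → ℝ) →L[ℝ] ℝ).smulRight
          (flowWord U (c i).1 (A (c i).2 ((flowWord U (c i).1).symm x)))).sum 0 := by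
  induction I using List.reverseRecOn with
  | nil => exact ⟨[], by simp, rfl, hasStrictFDerivAt_const _ _⟩
  | append_singleton I i ih =>
    obtain ⟨w, hw, hw0, hder⟩ := ih
    obtain ⟨v', hv'⟩ := h.exists_inv (c i).1
    set V := flowWord U (c i).1 with hV
    have hflow := (h.isFlow (c i).2).conj V
    have hcont : ContinuousWithinAt
        ((V : D →ₗ[ℂ] D) ∘ₗ A (c i).2 ∘ₗ (V.symm : D →ₗ[ℂ] D)) (states D M) x := by
      have h1 := (h.tangent (c i).2).continuousWithinAt hM (h.symm_mem (c i).1 hx)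
      have h2 := ContinuousWithinAt.comp (t := states D M) (x := x) h1
        V.symm.continuous.continuousWithinAt fun y hy => h.symm_mem (c i).1 hy
      exact V.continuous.continuousAt.comp_continuousWithinAt h2
    have h3 := hflow.hasStrictFDerivAt (M := M) (fun t y hy => h.flowWord_mem _
      (h.mapsTo _ t _ (h.symm_mem (c i).1 hy))) hcont hder
      (fun θ => h.flowWord_mem _ hx) hw0 (ContinuousLinearMap.proj i)
    have hval : ∀ θ, flowWord U (evalWord (w ++ (constWord (Fin n → ℝ) v' ++
        ((c i).2, fun θ => θ i) :: constWord (Fin n → ℝ) (c i).1)) θ) x =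
        V (U (c i).2 (θ i) (V.symm (flowWord U (evalWord w θ) x))) := by
      intro θ
      rw [evalWord_append, evalWord_append, evalWord_constWord, flowWord_append, flowWord_append,
        hv']
      change flowWord U (((c i).2, θ i) :: evalWord (constWord _ (c i).1) θ) _ = _
      rw [evalWord_constWord]
      rfl
    refine ⟨w ++ (constWord (Fin n → ℝ) v' ++
        ((c i).2, fun θ => θ i) :: constWord (Fin n → ℝ) (c i).1), ?_, ?_, ?_⟩
    · have hc : ∀ v : List (Fin r × ℝ), ∀ p ∈ constWord (Fin n → ℝ) v,
          ∃ K, LipschitzWith K p.2 := by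
        intro v p hp
        obtain ⟨q, -, rfl⟩ := List.mem_map.1 hp
        exact ⟨0, LipschitzWith.const _⟩
      intro p hp
      simp only [List.mem_append, List.mem_cons] at hp
      rcases hp with hp | hp | rfl | hp
      · exact hw p hp
      · exact hc _ p hp
      · exact ⟨1, LipschitzWith.eval i⟩
      · exact hc _ p hp
    · rw [hval, hw0, Pi.zero_apply, (h.isFlow _).map_zero, LinearIsometryEquiv.apply_symm_apply]
    · simp only [hval]
      rw [List.map_append, List.sum_append, List.map_singleton, List.sum_singleton]
      exact h3

/-- If the Lie algebra generated by the fields spans the tangent space at `x`, then there is a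
word of flows depending on `m` parameters which is a submersion onto `M ∩ D` at `x`. -/
theorem exists_submersion (h : IsFlowSystem m M A U) (hD : Dense (D : Set H))
    (hM : IsSubmanifold m (M ∩ (D : Set H))) {x : D} (hx : x ∈ states D M)
    (hrank : Module.rank ℝ (restrictAt (LieSubalgebra.lieSpan ℝ _ (Set.range A)) x) =
      (m : Cardinal)) :
    ∃ (P : D →L[ℝ] EuclideanSpace ℝ (Fin m)) (n : ℕ)
      (w : List (Fin r × ((Fin n → ℝ) → ℝ))) (L : (Fin n → ℝ) →L[ℝ] D),
      (∃ s ∈ 𝓝[states D M] x, Set.InjOn P s) ∧ (∀ p ∈ w, ∃ K, LipschitzWith K p.2) ∧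
      flowWord U (evalWord w 0) x = x ∧
      HasStrictFDerivAt (fun θ => flowWord U (evalWord w θ) x) L 0 ∧
      Function.Surjective (P.comp L) := by
  obtain ⟨P, hPs, hP⟩ := exists_linear_coord hM hx
  set 𝓑 := LieSubalgebra.lieSpan ℝ _ (Set.range A)
  set c : List (Fin r × ℝ) × Fin r → EuclideanSpace ℝ (Fin m) := fun p =>
    P (flowWord U p.1 (A p.2 ((flowWord U p.1).symm x)))
  have htan : ∀ B ∈ 𝓑, IsTangentField m M B := fun B hB =>
    .of_mem_lieSpan hD (by rintro _ ⟨l, rfl⟩; exact h.tangent l) hB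
  let ev : 𝓑 →ₗ[ℝ] D :=
    { toFun := fun B => (B : Module.End ℂ D) x
      map_add' := fun _ _ => rfl
      map_smul' := fun _ _ => rfl }
  -- `P` is injective on tangent vectors, so the `m`-dimensional space of values of the Lie algebra
  -- at `x` maps onto `ℝᵐ`; its image lies in the span of the transported fields.
  have hspan : Submodule.span ℝ (Set.range c) = ⊤ := by
    have h1 : LinearMap.range ((P : D →ₗ[ℝ] EuclideanSpace ℝ (Fin m)) ∘ₗ ev) ≤
        Submodule.span ℝ (Set.range c) := by
      rintro _ ⟨B, rfl⟩
      exact h.lieSpan_apply_mem hD hM P hx B.2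
    have h2 : Module.finrank ℝ (LinearMap.range ev) = m := by
      let j : D →ₗ[ℝ] H := (D.subtype).restrictScalars ℝ
      have hj : Function.Injective j := Subtype.val_injective
      have h3 : (LinearMap.range ev).map j = restrictAt 𝓑 x := by
        ext y
        constructor
        · rintro ⟨_, ⟨B, rfl⟩, rfl⟩
          exact ⟨B, B.2, rfl⟩
        · rintro ⟨B, hB, rfl⟩
          exact ⟨_, ⟨⟨B, hB⟩, rfl⟩, rfl⟩
      rw [(Submodule.equivMapOfInjective j hj (LinearMap.range ev)).finrank_eq, h3]
      exact Module.finrank_eq_of_rank_eq hrank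
    have h4 : Module.finrank ℝ
        (LinearMap.range ((P : D →ₗ[ℝ] EuclideanSpace ℝ (Fin m)) ∘ₗ ev)) = m := by
      have h5 : LinearMap.range ((P : D →ₗ[ℝ] EuclideanSpace ℝ (Fin m)) ∘ₗ ev) =
          LinearMap.range ((P : D →ₗ[ℝ] EuclideanSpace ℝ (Fin m)).domRestrict
            (LinearMap.range ev)) := by
        ext y
        constructor
        · rintro ⟨B, rfl⟩
          exact ⟨⟨_, B, rfl⟩, rfl⟩
        · rintro ⟨⟨_, B, rfl⟩, rfl⟩
          exact ⟨B, rfl⟩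
      rw [h5, LinearMap.finrank_range_of_inj, h2]
      rw [← LinearMap.ker_eq_bot, LinearMap.ker_eq_bot']
      rintro ⟨_, B, rfl⟩ hB
      exact Subtype.ext (hP _ (htan B B.2) hB)
    have h6 := Submodule.eq_top_of_finrank_eq (h4.trans finrank_euclideanSpace_fin.symm)
    exact top_le_iff.1 (h6 ▸ h1)
  obtain ⟨f, hf, hfspan, -⟩ := Submodule.exists_fun_fin_finrank_span_eq ℝ (Set.range c)
  choose p hp using hf
  obtain ⟨w, hw, hw0, hder⟩ := h.exists_word hM hx p (List.finRange _)
  refine ⟨P, _, w, _, hPs, hw, hw0, hder, fun y => ?_⟩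
  have hy : y ∈ Submodule.span ℝ (Set.range f) := by
    rw [hfspan, hspan]
    trivial
  obtain ⟨θ, hθ⟩ := (Submodule.mem_span_range_iff_exists_fun ℝ).1 hy
  refine ⟨θ, ?_⟩
  rw [← hθ, ← List.sum_ofFn, List.ofFn_eq_map]
  generalize List.finRange _ = I
  induction I with
  | nil => simp
  | cons i I ih =>
    simp only [List.map_cons, List.sum_cons] at ih ⊢
    rw [← ih, ContinuousLinearMap.comp_apply, ContinuousLinearMap.comp_apply,
      _root_.add_apply, map_add, ContinuousLinearMap.smulRight_apply, map_smul, ← hp i]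
    rfl

/-- The orbits of the flows are open in `M ∩ D`. -/
theorem eventually_mem_orbit (h : IsFlowSystem m M A U) (hD : Dense (D : Set H))
    (hM : IsSubmanifold m (M ∩ (D : Set H))) {x : D} (hx : x ∈ states D M)
    (hrank : Module.rank ℝ (restrictAt (LieSubalgebra.lieSpan ℝ _ (Set.range A)) x) =
      (m : Cardinal)) :
    ∀ᶠ y in 𝓝[states D M] x, ∃ w, flowWord U w x = y := by
  obtain ⟨P, n, w, L, ⟨s, hs, hinj⟩, -, hw0, hder, hsurj⟩ := h.exists_submersion hD hM hx hrank
  have h1 : HasStrictFDerivAt (fun θ => P (flowWord U (evalWord w θ) x)) (P.comp L) 0 :=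
    P.hasStrictFDerivAt.comp 0 hder
  -- `P` composed with the word is open at `0`, and injectivity of `P` on `s` lifts this openness
  -- back to `M ∩ D`.
  have h2 := h1.map_nhds_eq_of_surj (LinearMap.range_eq_top.2 hsurj)
  rw [hw0] at h2
  have h3 : ∀ᶠ θ in 𝓝 (0 : Fin n → ℝ), flowWord U (evalWord w θ) x ∈ s := by
    have h4 : Filter.Tendsto (fun θ => flowWord U (evalWord w θ) x) (𝓝 0) (𝓝[states D M] x) :=
      tendsto_nhdsWithin_iff.2 ⟨by simpa [hw0] using hder.continuousAt.tendsto,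
        Filter.Eventually.of_forall fun θ => h.flowWord_mem _ hx⟩
    exact h4 hs
  have h5 : P '' ((fun θ => flowWord U (evalWord w θ) x) ''
      {θ | flowWord U (evalWord w θ) x ∈ s}) ∈ 𝓝 (P x) := by
    rw [← h2, Set.image_image]
    exact Filter.image_mem_map h3
  filter_upwards [hs, nhdsWithin_le_nhds (P.continuous.continuousAt h5)] with y hy hy5
  obtain ⟨_, ⟨θ, hθ, rfl⟩, hPθ⟩ := hy5
  exact ⟨_, hinj hθ hy hPθ⟩

/-- Under the rank condition the flows act transitively on `M ∩ D` when this set is dense in the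
connected set `M`. -/
theorem exists_flowWord_eq (h : IsFlowSystem m M A U) (hD : Dense (D : Set H))
    (hM : IsSubmanifold m (M ∩ (D : Set H))) (hconn : IsPreconnected M)
    (hdense : M ⊆ closure (M ∩ (D : Set H)))
    (hrank : ∀ x ∈ states D M,
      Module.rank ℝ (restrictAt (LieSubalgebra.lieSpan ℝ _ (Set.range A)) x) = (m : Cardinal))
    {x y : D} (hx : x ∈ states D M) (hy : y ∈ states D M) : ∃ w, flowWord U w x = y := by
  set O : Set D := {y | ∃ w, flowWord U w x = y}
  have hOM : O ⊆ states D M := by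
    rintro _ ⟨w, rfl⟩
    exact h.flowWord_mem w hx
  obtain ⟨δ, hδ, hK⟩ : ∃ δ > 0, IsCompact (O ∩ Metric.closedBall x δ) := by
    obtain ⟨C, hC, hCM, hCx⟩ := exists_compact_nhdsWithin hM hx
    have h1 := Filter.inter_mem hCx (h.eventually_mem_orbit hD hM hx (hrank x hx))
    obtain ⟨δ, hδ, hsub⟩ := (nhdsWithin_hasBasis Metric.nhds_basis_closedBall _).mem_iff.1 h1
    refine ⟨δ, hδ, ?_⟩
    have h2 : O ∩ Metric.closedBall x δ = C ∩ Metric.closedBall x δ := by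
      ext z
      constructor
      · rintro ⟨hz, hzx⟩
        exact ⟨(hsub ⟨hzx, hOM hz⟩).1, hzx⟩
      · rintro ⟨hz, hzx⟩
        exact ⟨(hsub ⟨hzx, hCM z hz⟩).2, hzx⟩
    rw [h2]
    exact hC.inter_right Metric.isClosed_closedBall
  -- Words are isometries that permute the orbit, so the same radius `δ` serves at every point of
  -- `O`.
  have hKO : ∀ z ∈ O, IsCompact (O ∩ Metric.closedBall z δ) := by
    rintro _ ⟨w, rfl⟩
    obtain ⟨w', hw'⟩ := h.exists_inv w
    have h1 : O ∩ Metric.closedBall (flowWord U w x) δ =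
        flowWord U w '' (O ∩ Metric.closedBall x δ) := by
      ext z
      constructor
      · rintro ⟨⟨v, rfl⟩, hz⟩
        refine ⟨(flowWord U w).symm (flowWord U v x), ⟨⟨v ++ w', ?_⟩, ?_⟩, by simp⟩
        · rw [flowWord_append, hw']
        · rwa [Metric.mem_closedBall, ← (flowWord U w).dist_map, LinearIsometryEquiv.apply_symm_apply]
      · rintro ⟨_, ⟨⟨v, rfl⟩, hz⟩, rfl⟩
        exact ⟨⟨v ++ w, by rw [flowWord_append]⟩, by
          rwa [Metric.mem_closedBall, (flowWord U w).dist_map]⟩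
    rw [h1]
    exact hK.image (flowWord U w).continuous
  set O' : Set H := Subtype.val '' O
  -- A limit of orbit points lies within `δ / 2` of some `z ∈ O`, hence in the closure of a compact
  -- piece of the orbit. This gives closedness in `H` itself, and not merely in `D`.
  have hclosed : IsClosed O' := by
    refine isClosed_of_closure_subset fun p hp => ?_
    obtain ⟨_, ⟨z, hz, rfl⟩, hzp⟩ := Metric.mem_closure_iff.1 hp (δ / 2) (by positivity)
    have hc : IsClosed ((Subtype.val : D → H) '' (O ∩ Metric.closedBall z δ)) :=
      ((hKO z hz).image continuous_subtype_val).isClosed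
    have h1 : p ∈ closure ((Subtype.val : D → H) '' (O ∩ Metric.closedBall z δ)) := by
      refine Metric.mem_closure_iff.2 fun ε hε => ?_
      obtain ⟨_, ⟨z', hz', rfl⟩, hz'p⟩ := Metric.mem_closure_iff.1 hp (min ε (δ / 2))
        (lt_min hε (by positivity))
      refine ⟨z', ⟨z', ⟨hz', ?_⟩, rfl⟩, hz'p.trans_le (min_le_left _ _)⟩
      have h2 : dist z' z = dist (z' : H) (z : H) := rfl
      rw [Metric.mem_closedBall, h2]
      have h3 := dist_triangle_left (z' : H) z p
      have h4 := hz'p.trans_le (min_le_right _ _)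
      linarith
    rw [hc.closure_eq] at h1
    obtain ⟨z', hz', rfl⟩ := h1
    exact ⟨z', hz'.1, rfl⟩
  -- Connectedness is assumed for `M` and not for `M ∩ D`. Points of `M` near `z` are limits of
  -- points of `M ∩ D` near `z`; these are in the orbit, which is closed.
  have hopen : ∀ p ∈ M ∩ O', O' ∈ 𝓝[M] p := by
    rintro _ ⟨hp, z, hz, rfl⟩
    have h1 : ∀ᶠ y in 𝓝[states D M] z, y ∈ O := by
      filter_upwards [h.eventually_mem_orbit hD hM hp (hrank z hp)] with y ⟨v, hv⟩
      obtain ⟨w, hw⟩ := hz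
      exact ⟨w ++ v, by rw [flowWord_append, hw, hv]⟩
    obtain ⟨ε, hε, hsub⟩ := Metric.nhdsWithin_basis_ball.mem_iff.1 h1
    rw [Metric.nhdsWithin_basis_ball.mem_iff]
    refine ⟨ε, hε, fun q ⟨hqb, hqM⟩ => ?_⟩
    rw [← hclosed.closure_eq]
    have h2 : q ∈ closure (Metric.ball (z : H) ε ∩ (M ∩ (D : Set H))) :=
      Metric.isOpen_ball.inter_closure ⟨hqb, hdense hqM⟩
    refine closure_mono ?_ h2
    rintro q' ⟨hq'b, hq'M, hq'D⟩
    exact ⟨⟨q', hq'D⟩, hsub ⟨hq'b, hq'M⟩, rfl⟩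
  have hall : M ⊆ O' := by
    have hxO : (x : H) ∈ O' := ⟨x, ⟨[], rfl⟩, rfl⟩
    choose! V hV using fun p hp => mem_nhdsWithin.1 (hopen p hp)
    intro p hp
    by_contra hpO
    obtain ⟨q, hqM, hqV, hqO⟩ := hconn (⋃ p ∈ M ∩ O', V p) O'ᶜ
      (isOpen_biUnion fun p hp => (hV p hp).1) hclosed.isOpen_compl (fun q hq => by
        by_cases hqO : q ∈ O'
        · exact Or.inl (Set.mem_biUnion ⟨hq, hqO⟩ (hV q ⟨hq, hqO⟩).2.1)
        · exact Or.inr hqO)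
      ⟨x, hx, Set.mem_biUnion ⟨hx, hxO⟩ (hV x ⟨hx, hxO⟩).2.1⟩ ⟨p, hp, hpO⟩
    obtain ⟨p', hp', hqp'⟩ := Set.mem_iUnion₂.1 hqV
    exact hqO ((hV p' hp').2.2 ⟨hqp', hqM⟩)
  obtain ⟨z, hz, hzy⟩ := hall hy
  rwa [Subtype.ext hzy] at hz

end IsFlowSystem

end Orbits

/-! ### Estimates near the frozen time, uniform on compact sets of states. -/

section UniformEstimates

variable {H : Type*} [NormedAddCommGroup H] [InnerProductSpace ℂ H] {D : Submodule ℂ H}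
  {m : ℕ} {M : Set H} {t₀ T : ℝ} {A : ℝ → Module.End ℂ D} {K : Set D}

namespace IsSmoothVectorField

theorem continuousAt_uncurry (hA : IsSmoothVectorField m M t₀ A)
    (hM : IsSubmanifold m (M ∩ (D : Set H))) (hT : t₀ < T) {p : D} (hp : p ∈ states D M) :
    ContinuousWithinAt (fun q : ℝ × D => A q.1 q.2) (Set.univ ×ˢ states D M) (T, p) := by
  obtain ⟨X, hX, hev⟩ := hA.exists_ambient hM hT hp
  rw [Topology.IsInducing.subtypeVal.continuousWithinAt_iff]
  have h1 : ContinuousAt (fun q : ℝ × D => X (q.1, (q.2 : H))) (T, p) :=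
    ContinuousAt.comp (f := fun q : ℝ × D => (q.1, (q.2 : H))) hX.continuousAt (by fun_prop)
  refine h1.continuousWithinAt.congr_of_eventuallyEq ?_ ?_
  · rw [nhdsWithin_prod_eq, nhdsWithin_univ]
    filter_upwards [Filter.tendsto_snd.eventually hev] with q hq
    exact hq q.1
  · exact hev.self_of_nhdsWithin hp T

/-- Near `(T, p)` the difference `A t - A T` has a small Lipschitz constant, and `A T` is
Lipschitz. -/
theorem eventually_lipschitz (hA : IsSmoothVectorField m M t₀ A)
    (hM : IsSubmanifold m (M ∩ (D : Set H))) (hT : t₀ < T) {p : D} (hp : p ∈ states D M) :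
    (∀ η > 0, ∀ᶠ q : ℝ × D × D in 𝓝 (T, p, p), q.2.1 ∈ states D M → q.2.2 ∈ states D M →
      ‖(A q.1 q.2.1 - A T q.2.1) - (A q.1 q.2.2 - A T q.2.2)‖ ≤ η * ‖q.2.1 - q.2.2‖) ∧
    ∃ C, ∀ᶠ q : D × D in 𝓝 (p, p), q.1 ∈ states D M → q.2 ∈ states D M →
      ‖A T q.1 - A T q.2‖ ≤ C * ‖q.1 - q.2‖ := by
  obtain ⟨X, hX, hev⟩ := hA.exists_ambient hM hT hp
  have hstrict := (hX.hasStrictFDerivAt (by simp)).isLittleO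
  set X' := fderiv ℝ X (T, (p : H))
  rw [eventually_nhdsWithin_iff] at hev
  have hnorm : ∀ (s : ℝ) (y y' : D), ‖((s, (y : H)) - (s, (y' : H)) : ℝ × H)‖ = ‖y - y'‖ := by
    intro s y y'
    simp [Prod.norm_def]
  -- Strict differentiability of the ambient extension at `(T, p)`, used for two points with the
  -- same time coordinate. Subtracting the case of time `T` cancels the linear part.
  have hclose : ∀ η > 0, ∀ᶠ q : ℝ × D × D in 𝓝 (T, p, p), 
      ‖X (q.1, (q.2.1 : H)) - X (q.1, (q.2.2 : H)) - X' (0, (q.2.1 : H) - q.2.2)‖ ≤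
        η * ‖q.2.1 - q.2.2‖ := by
    intro η hη
    have h1 := Asymptotics.isLittleO_iff.1 hstrict hη
    have h2 : Continuous fun q : ℝ × D × D => ((q.1, (q.2.1 : H)), (q.1, (q.2.2 : H))) := by
      fun_prop
    filter_upwards [(h2.tendsto (T, p, p)).eventually h1] with q hq
    rw [hnorm] at hq
    simpa using hq
  have hmem : ∀ᶠ q : D × D in 𝓝 (p, p), q.1 ∈ states D M → q.2 ∈ states D M →
      ∀ s, (A s q.1 : H) = X (s, q.1) ∧ (A s q.2 : H) = X (s, q.2) := by
    filter_upwards [(continuous_fst.tendsto (p, p)).eventually hev,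
      (continuous_snd.tendsto (p, p)).eventually hev] with q h1 h2 h3 h4 s
    exact ⟨h1 h3 s, h2 h4 s⟩
  have hfix : ∀ η > 0, ∀ᶠ q : D × D in 𝓝 (p, p),
      ‖X (T, (q.1 : H)) - X (T, (q.2 : H)) - X' (0, (q.1 : H) - q.2)‖ ≤ η * ‖q.1 - q.2‖ := by
    intro η hη
    have h2 : Continuous fun q : D × D => (T, q.1, q.2) := by fun_prop
    exact (h2.tendsto (p, p)).eventually (hclose η hη)
  constructor
  · intro η hη
    filter_upwards [hclose (η / 2) (by positivity),
      (continuous_snd.tendsto (T, p, p)).eventually (hfix (η / 2) (by positivity)),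
      (continuous_snd.tendsto (T, p, p)).eventually hmem] with q h1 h2 h3 h4 h5
    have h6 := h3 h4 h5
    rw [Submodule.coe_norm]
    simp only [Submodule.coe_sub]
    rw [(h6 _).1, (h6 _).2, (h6 _).1, (h6 _).2]
    calc _ = ‖(X (q.1, (q.2.1 : H)) - X (q.1, (q.2.2 : H)) - X' (0, (q.2.1 : H) - q.2.2)) -
          (X (T, (q.2.1 : H)) - X (T, (q.2.2 : H)) - X' (0, (q.2.1 : H) - q.2.2))‖ := by
          congr 1; abel
      _ ≤ _ := (norm_sub_le _ _).trans (by linarith)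
  · refine ⟨1 + ‖X'‖, ?_⟩
    filter_upwards [hfix 1 one_pos, hmem] with q h2 h3 h4 h5
    have h6 := h3 h4 h5
    rw [Submodule.coe_norm]
    simp only [Submodule.coe_sub]
    rw [(h6 _).1, (h6 _).2]
    have h7 : ‖X' (0, (q.1 : H) - q.2)‖ ≤ ‖X'‖ * ‖q.1 - q.2‖ := by
      refine (X'.le_opNorm _).trans (le_of_eq ?_)
      congr 1
      simp [Prod.norm_def]
    calc _ = ‖(X (T, (q.1 : H)) - X (T, (q.2 : H)) - X' (0, (q.1 : H) - q.2)) +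
          X' (0, (q.1 : H) - q.2)‖ := by congr 1; abel
      _ ≤ _ := (norm_add_le _ _).trans (by linarith)

/-- Near the diagonal of `K ×ˢ K` the local estimate applies. Off the diagonal `‖y - y'‖` is locally
bounded below, so smallness of `A t - A T` suffices; compactness joins the two cases. -/
theorem eventually_lipschitz_compact (hA : IsSmoothVectorField m M t₀ A)
    (hM : IsSubmanifold m (M ∩ (D : Set H))) (hT : t₀ < T) (hK : IsCompact K)
    (hKM : K ⊆ states D M) {η : ℝ} (hη : 0 < η) :
    ∀ᶠ t in 𝓝 T, ∀ y ∈ K, ∀ y' ∈ K,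
      ‖(A t y - A T y) - (A t y' - A T y')‖ ≤ η * ‖y - y'‖ := by
  have key := (hK.prod hK).eventually_forall_of_forall_eventually (x₀ := T)
    (P := fun t q => q.1 ∈ states D M → q.2 ∈ states D M →
      ‖(A t q.1 - A T q.1) - (A t q.2 - A T q.2)‖ ≤ η * ‖q.1 - q.2‖) ?_
  · filter_upwards [key] with t ht y hy y' hy'
    exact ht (y, y') ⟨hy, hy'⟩ (hKM hy) (hKM hy')
  · rintro ⟨p, p'⟩ ⟨hp, hp'⟩
    by_cases hpp : p = p'
    · subst hpp
      exact (hA.eventually_lipschitz hM hT (hKM hp)).1 η hη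
    · have hpos : 0 < ‖p - p'‖ := norm_pos_iff.2 (sub_ne_zero.2 hpp)
      have hsmall : ∀ z ∈ K, ∀ᶠ q : ℝ × D in 𝓝 (T, z), q.2 ∈ states D M →
          ‖A q.1 q.2 - A T q.2‖ ≤ η * ‖p - p'‖ / 4 := by
        intro z hz
        have h1 := hA.continuousAt_uncurry hM hT (hKM hz)
        have h2 : ContinuousWithinAt (fun q : ℝ × D => A T q.2) (Set.univ ×ˢ states D M) (T, z) :=
          ContinuousWithinAt.comp (f := fun q : ℝ × D => (T, q.2)) (x := (T, z)) h1
            (by fun_prop) fun q hq => ⟨trivial, hq.2⟩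
        have h3 := ((h1.sub h2).norm).eventually (Iic_mem_nhds
          (show ‖A T z - A T z‖ < η * ‖p - p'‖ / 4 by rw [sub_self, norm_zero]; positivity))
        rw [eventually_nhdsWithin_iff] at h3
        filter_upwards [h3] with q hq hqM
        exact hq ⟨trivial, hqM⟩
      have hfar : ∀ᶠ q : ℝ × D × D in 𝓝 (T, p, p'), ‖p - p'‖ / 2 < ‖q.2.1 - q.2.2‖ := by
        have : Continuous fun q : ℝ × D × D => ‖q.2.1 - q.2.2‖ := by fun_prop
        exact (this.tendsto (T, p, p')).eventually (lt_mem_nhds (half_lt_self hpos))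
      have c1 : Continuous fun q : ℝ × D × D => (q.1, q.2.1) := by fun_prop
      have c2 : Continuous fun q : ℝ × D × D => (q.1, q.2.2) := by fun_prop
      filter_upwards [hfar, (c1.tendsto (T, p, p')).eventually (hsmall p hp),
        (c2.tendsto (T, p, p')).eventually (hsmall p' hp')] with q h1 h2 h3 h4 h5
      have h6 := norm_sub_le (A q.1 q.2.1 - A T q.2.1) (A q.1 q.2.2 - A T q.2.2)
      have h7 := mul_le_mul_of_nonneg_left h1.le hη.le
      have h8 := h2 h4
      have h9 := h3 h5
      linarith

theorem exists_lipschitz_compact (hA : IsSmoothVectorField m M t₀ A)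
    (hM : IsSubmanifold m (M ∩ (D : Set H))) (hT : t₀ < T) (hK : IsCompact K)
    (hKM : K ⊆ states D M) :
    ∃ C, 0 ≤ C ∧ ∀ y ∈ K, ∀ y' ∈ K, ‖A T y - A T y'‖ ≤ C * ‖y - y'‖ := by
  have hcont : ∀ p ∈ K, ∀ᶠ y in 𝓝 p, y ∈ states D M → ‖A T y‖ ≤ ‖A T p‖ + 1 := by
    intro p hp
    have h1 := hA.continuousAt_uncurry hM hT (hKM hp)
    have h2 : ContinuousWithinAt (fun y : D => A T y) (states D M) p :=
      ContinuousWithinAt.comp (f := fun y : D => (T, y)) (x := p) h1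
        (by fun_prop) fun q hq => ⟨trivial, hq⟩
    have h3 := h2.norm.eventually (Iic_mem_nhds (lt_add_one ‖A T p‖))
    rwa [eventually_nhdsWithin_iff] at h3
  have key : ∃ C, 0 ≤ C ∧ ∀ q ∈ K ×ˢ K, ‖A T q.1 - A T q.2‖ ≤ C * ‖q.1 - q.2‖ := by
    refine (hK.prod hK).induction_on
      (p := fun s => ∃ C, 0 ≤ C ∧ ∀ q ∈ s, ‖A T q.1 - A T q.2‖ ≤ C * ‖q.1 - q.2‖)
      ⟨0, le_rfl, by simp⟩ ?_ ?_ ?_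
    · rintro s t hst ⟨C, hC0, hC⟩
      exact ⟨C, hC0, fun q hq => hC q (hst hq)⟩
    · rintro s t ⟨C, hC0, hC⟩ ⟨C', hC0', hC'⟩
      refine ⟨C + C', by positivity, ?_⟩
      rintro q (hq | hq)
      · have := hC q hq
        nlinarith [norm_nonneg (q.1 - q.2)]
      · have := hC' q hq
        nlinarith [norm_nonneg (q.1 - q.2)]
    · rintro ⟨p, p'⟩ ⟨hp, hp'⟩
      suffices h : ∃ C, ∀ᶠ q : D × D in 𝓝 (p, p'), q.1 ∈ states D M → q.2 ∈ states D M →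
          ‖A T q.1 - A T q.2‖ ≤ C * ‖q.1 - q.2‖ by
        obtain ⟨C, hC⟩ := h
        refine ⟨_, Filter.inter_mem self_mem_nhdsWithin (nhdsWithin_le_nhds hC), |C|,
          abs_nonneg C, ?_⟩
        rintro q ⟨hqK, hq⟩
        exact (hq (hKM hqK.1) (hKM hqK.2)).trans
          (mul_le_mul_of_nonneg_right (le_abs_self C) (norm_nonneg _))
      by_cases hpp : p = p'
      · subst hpp
        exact (hA.eventually_lipschitz hM hT (hKM hp)).2
      · have hpos : 0 < ‖p - p'‖ := norm_pos_iff.2 (sub_ne_zero.2 hpp)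
        refine ⟨(‖A T p‖ + 1 + (‖A T p'‖ + 1)) / (‖p - p'‖ / 2), ?_⟩
        have hfar : ∀ᶠ q : D × D in 𝓝 (p, p'), ‖p - p'‖ / 2 < ‖q.1 - q.2‖ := by
          have : Continuous fun q : D × D => ‖q.1 - q.2‖ := by fun_prop
          exact (this.tendsto (p, p')).eventually (lt_mem_nhds (half_lt_self hpos))
        filter_upwards [hfar, (continuous_fst.tendsto (p, p')).eventually (hcont p hp),
          (continuous_snd.tendsto (p, p')).eventually (hcont p' hp')] with q h1 h2 h3 h4 h5
        have h6 := norm_sub_le (A T q.1) (A T q.2)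
        have h8 := h2 h4
        have h9 := h3 h5
        rw [div_mul_eq_mul_div, le_div_iff₀ (by positivity)]
        refine mul_le_mul (by linarith) h1.le (by positivity) (by positivity)
  obtain ⟨C, hC0, hC⟩ := key
  exact ⟨C, hC0, fun y hy y' hy' => hC (y, y') ⟨hy, hy'⟩⟩

/-- The point `z` is not confined to `K`, because it will lie on a trajectory known only to stay
close to `K`. -/
theorem exists_norm_sub_le_compact (hA : IsSmoothVectorField m M t₀ A)
    (hM : IsSubmanifold m (M ∩ (D : Set H))) (hT : t₀ < T) (hK : IsCompact K)
    (hKM : K ⊆ states D M) {η : ℝ} (hη : 0 < η) :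
    ∃ δ > 0, ∀ t, |t - T| < δ → ∀ y ∈ K, ∀ z ∈ states D M, ‖z - y‖ < δ →
      ‖A t z - A T y‖ ≤ η := by
  have key := hK.eventually_forall_of_forall_eventually (x₀ := (T, (0 : D)))
    (P := fun q y => y ∈ states D M → y + q.2 ∈ states D M → ‖A q.1 (y + q.2) - A T y‖ ≤ η) ?_
  · obtain ⟨δ, hδ, h⟩ := Metric.eventually_nhds_iff.1 key
    refine ⟨δ, hδ, fun t ht y hy z hz hzy => ?_⟩
    have := @h (t, z - y) (by
      rw [Prod.dist_eq, max_lt_iff]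
      exact ⟨by rwa [Real.dist_eq], by simpa using hzy⟩) y hy (hKM hy) (by simpa using hz)
    simpa using this
  · intro p hp
    have h1 := hA.continuousAt_uncurry hM hT (hKM hp)
    have h2 := h1.eventually (Metric.closedBall_mem_nhds (A T p) (half_pos hη))
    rw [eventually_nhdsWithin_iff] at h2
    have c1 : Continuous fun q : (ℝ × D) × D => (q.1.1, q.2 + q.1.2) := by fun_prop
    have c2 : Continuous fun q : (ℝ × D) × D => (T, q.2) := by fun_prop
    filter_upwards [(c1.tendsto' ((T, 0), p) (T, p) (by simp)).eventually h2,
      (c2.tendsto' ((T, 0), p) (T, p) rfl).eventually h2] with q h3 h4 h5 h6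
    have h7 := h3 ⟨trivial, h6⟩
    have h8 := h4 ⟨trivial, h5⟩
    rw [dist_eq_norm] at h7 h8
    calc _ = ‖(A q.1.1 (q.2 + q.1.2) - A T p) - (A T q.2 - A T p)‖ := by congr 1; abel
      _ ≤ _ := (norm_sub_le _ _).trans (by linarith)

theorem exists_norm_le_compact (hA : IsSmoothVectorField m M t₀ A)
    (hM : IsSubmanifold m (M ∩ (D : Set H))) (hT : t₀ < T) (hK : IsCompact K)
    (hKM : K ⊆ states D M) : ∃ C, 0 ≤ C ∧ ∀ y ∈ K, ‖A T y‖ ≤ C := by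
  have h1 : ContinuousOn (fun y : D => A T y) K := fun p hp =>
    (ContinuousWithinAt.comp (f := fun y : D => (T, y)) (x := p)
      (hA.continuousAt_uncurry hM hT (hKM hp)) (by fun_prop)
      fun q hq => ⟨trivial, hq⟩ : ContinuousWithinAt _ (states D M) p).mono hKM
  obtain ⟨C, hC⟩ := hK.exists_bound_of_continuousOn h1
  exact ⟨|C|, abs_nonneg C, fun y hy => (hC y hy).trans (le_abs_self C)⟩

end IsSmoothVectorField

end UniformEstimates

/-! ### A single strong pulse compared with the frozen flow. -/

section StepEstimate

variable {H : Type*} [NormedAddCommGroup H] [InnerProductSpace ℂ H] {D : Submodule ℂ H}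
  {m : ℕ} {M : Set H}

theorem IsSkewHermitian.norm_sub_le_of_hasDerivAt {A : ℝ → Module.End ℂ D} {a b ρ : ℝ}
    (hab : a ≤ b) (hρ : 0 ≤ ρ) (hA : ∀ t ∈ Set.Ioo a b, IsSkewHermitian (A t)) {d R : ℝ → D}
    (hc : ContinuousOn d (Set.Icc a b))
    (hd : ∀ t ∈ Set.Ioo a b, HasDerivAt d (A t (d t) + R t) t)
    (hR : ∀ t ∈ Set.Ioo a b, ‖R t‖ ≤ ρ) : ‖d b‖ ≤ ‖d a‖ + ρ * (b - a) :=
  IsSkewHermitian.norm_sub_le (R := fun t => (R t : H)) hab hρ hA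
    (continuous_subtype_val.comp_continuousOn hc) (fun t ht => hasDerivAt_coe_iff.2 (hd t ht)) hR

variable {B C : ℝ → Module.End ℂ D} {C' : Module.End ℂ D} {s ε : ℝ}

/-- A trajectory under a strong constant control over a short time, compared with a curve driven by
the frozen control field. -/
theorem norm_sub_le_of_strong_control (hε : 0 < ε)
    (hB : ∀ t ∈ Set.Ioo s (s + ε), IsSkewHermitian (B t))
    (hC : ∀ t ∈ Set.Ioo s (s + ε), IsSkewHermitian (C t)) {c : ℝ} {z w : ℝ → D}
    (hz : ContinuousOn z (Set.Icc s (s + ε))) (hw : ContinuousOn w (Set.Icc s (s + ε)))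
    (hz' : ∀ t ∈ Set.Ioo s (s + ε), HasDerivAt z ((B t + (c / ε) • C t) (z t)) t)
    (hw' : ∀ t ∈ Set.Ioo s (s + ε), HasDerivAt w ((c / ε) • C' (w t)) t) {β γ : ℝ}
    (hβ : 0 ≤ β) (hγ : 0 ≤ γ) (hBw : ∀ t ∈ Set.Ioo s (s + ε), ‖B t (w t)‖ ≤ β)
    (hCw : ∀ t ∈ Set.Ioo s (s + ε), ‖C t (w t) - C' (w t)‖ ≤ γ) {t : ℝ}
    (ht : t ∈ Set.Icc s (s + ε)) : ‖z t - w t‖ ≤ ‖z s - w s‖ + (ε * β + |c| * γ) := by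
  have hsub : Set.Ioo s t ⊆ Set.Ioo s (s + ε) := Set.Ioo_subset_Ioo_right ht.2
  have hsub' : Set.Icc s t ⊆ Set.Icc s (s + ε) := Set.Icc_subset_Icc_right ht.2
  have h := IsSkewHermitian.norm_sub_le_of_hasDerivAt (A := fun t => B t + (c / ε) • C t)
    (d := fun t => z t - w t) (R := fun t => B t (w t) + (c / ε) • (C t (w t) - C' (w t)))
    (ρ := β + |c| / ε * γ) ht.1 (by positivity)
    (fun t ht => (hB t (hsub ht)).add ((hC t (hsub ht)).smul _))
    ((hz.sub hw).mono hsub') (fun t ht => by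
      refine ((hz' t (hsub ht)).sub (hw' t (hsub ht))).congr_deriv ?_
      simp only [LinearMap.add_apply, LinearMap.smul_apply, map_sub, smul_sub]
      abel)
    (fun t ht => by
      refine (norm_add_le _ _).trans (add_le_add (hBw t (hsub ht)) ?_)
      rw [norm_smul, Real.norm_eq_abs, abs_div, abs_of_pos hε]
      exact mul_le_mul_of_nonneg_left (hCw t (hsub ht)) (by positivity))
  refine h.trans ?_
  have h1 : (β + |c| / ε * γ) * (t - s) ≤ (β + |c| / ε * γ) * ε :=
    mul_le_mul_of_nonneg_left (by linarith [ht.2]) (by positivity)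
  have h2 : (β + |c| / ε * γ) * ε = ε * β + |c| * γ := by field_simp
  linarith

/-- Second differences of trajectories under two strong constant controls. -/
theorem norm_sub_sub_le_of_strong_control (hε : 0 < ε)
    (hB : ∀ t ∈ Set.Ioo s (s + ε), IsSkewHermitian (B t))
    (hC : ∀ t ∈ Set.Ioo s (s + ε), IsSkewHermitian (C t)) {c₁ c₂ : ℝ} {z₁ w₁ z₂ w₂ : ℝ → D}
    (hz₁ : ContinuousOn z₁ (Set.Icc s (s + ε))) (hw₁ : ContinuousOn w₁ (Set.Icc s (s + ε)))
    (hz₂ : ContinuousOn z₂ (Set.Icc s (s + ε))) (hw₂ : ContinuousOn w₂ (Set.Icc s (s + ε)))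
    (hz₁' : ∀ t ∈ Set.Ioo s (s + ε), HasDerivAt z₁ ((B t + (c₁ / ε) • C t) (z₁ t)) t)
    (hw₁' : ∀ t ∈ Set.Ioo s (s + ε), HasDerivAt w₁ ((c₁ / ε) • C' (w₁ t)) t)
    (hz₂' : ∀ t ∈ Set.Ioo s (s + ε), HasDerivAt z₂ ((B t + (c₂ / ε) • C t) (z₂ t)) t)
    (hw₂' : ∀ t ∈ Set.Ioo s (s + ε), HasDerivAt w₂ ((c₂ / ε) • C' (w₂ t)) t) {β γ ζ : ℝ}
    (hβ : 0 ≤ β) (hγ : 0 ≤ γ) (hζ : 0 ≤ ζ)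
    (hBw : ∀ t ∈ Set.Ioo s (s + ε), ‖B t (w₁ t) - B t (w₂ t)‖ ≤ β)
    (hCw : ∀ t ∈ Set.Ioo s (s + ε),
      ‖(C t (w₁ t) - C' (w₁ t)) - (C t (w₂ t) - C' (w₂ t))‖ ≤ γ)
    (hCz : ∀ t ∈ Set.Ioo s (s + ε), ‖C t (z₂ t) - C' (w₂ t)‖ ≤ ζ) :
    ‖(z₁ (s + ε) - w₁ (s + ε)) - (z₂ (s + ε) - w₂ (s + ε))‖ ≤
      ‖(z₁ s - w₁ s) - (z₂ s - w₂ s)‖ + (ε * β + |c₁| * γ + |c₁ - c₂| * ζ) := by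
  have h := IsSkewHermitian.norm_sub_le_of_hasDerivAt (A := fun t => B t + (c₁ / ε) • C t)
    (d := fun t => (z₁ t - w₁ t) - (z₂ t - w₂ t))
    (R := fun t => (B t (w₁ t) - B t (w₂ t)) +
      (c₁ / ε) • ((C t (w₁ t) - C' (w₁ t)) - (C t (w₂ t) - C' (w₂ t))) +
      -- The two amplitudes differ while the energy estimate uses one generator, that of `c₁`; this
      -- term is the price. It involves `z₂` itself, so closeness of `z₂` to `w₂` has to be known
      -- beforehand.
      ((c₁ - c₂) / ε) • (C t (z₂ t) - C' (w₂ t)))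
    (ρ := β + |c₁| / ε * γ + |c₁ - c₂| / ε * ζ) (by linarith : s ≤ s + ε) (by positivity)
    (fun t ht => (hB t ht).add ((hC t ht).smul _))
    ((hz₁.sub hw₁).sub (hz₂.sub hw₂)) (fun t ht => by
      refine (((hz₁' t ht).sub (hw₁' t ht)).sub ((hz₂' t ht).sub (hw₂' t ht))).congr_deriv ?_
      simp only [LinearMap.add_apply, LinearMap.smul_apply, map_sub, smul_sub, sub_div, sub_smul]
      abel)
    (fun t ht => by
      refine (norm_add₃_le).trans (add_le_add (add_le_add (hBw t ht) ?_) ?_)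
      · rw [norm_smul, Real.norm_eq_abs, abs_div, abs_of_pos hε]
        exact mul_le_mul_of_nonneg_left (hCw t ht) (by positivity)
      · rw [norm_smul, Real.norm_eq_abs, abs_div, abs_of_pos hε]
        exact mul_le_mul_of_nonneg_left (hCz t ht) (by positivity))
  have h2 : (β + |c₁| / ε * γ + |c₁ - c₂| / ε * ζ) * (s + ε - s) =
      ε * β + |c₁| * γ + |c₁ - c₂| * ζ := by
    rw [add_sub_cancel_left]
    field_simp
  rwa [h2] at h

/-- The family `F ε` tends to zero as `ε ↓ 0`, uniformly on `W` and together with its Lipschitz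
constant on `W`. -/
def TendsToZeroLip {Θ E : Type*} [NormedAddCommGroup Θ] [NormedAddCommGroup E] (W : Set Θ)
    (F : ℝ → Θ → E) : Prop :=
  ∀ η > 0, ∀ᶠ ε in 𝓝[>] (0 : ℝ), ∀ θ ∈ W, ‖F ε θ‖ ≤ η ∧
    ∀ θ' ∈ W, ‖F ε θ - F ε θ'‖ ≤ η * ‖θ - θ'‖

/-- One letter of a word: a strong control over a time interval of length `ε` near `T` acts, in the
limit `ε ↓ 0`, like the flow of the control field frozen at time `T`. -/
theorem TendsToZeroLip.step {t₀ T : ℝ} (hT : t₀ < T) (hM : IsSubmanifold m (M ∩ (D : Set H)))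
    {B C : ℝ → Module.End ℂ D} (hB : IsSmoothVectorField m M t₀ B)
    (hC : IsSmoothVectorField m M t₀ C) (hBs : ∀ t, t₀ ≤ t → IsSkewHermitian (B t))
    (hCs : ∀ t, t₀ ≤ t → IsSkewHermitian (C t)) {U : ℝ → (D ≃ₗᵢ[ℂ] D)} (hU : IsFlow (C T) U)
    (hUM : ∀ t, ∀ x ∈ states D M, U t x ∈ states D M)
    {Θ : Type*} [NormedAddCommGroup Θ] {W : Set Θ} (hW : IsCompact W) {y : Θ → D} {Ly : NNReal}
    (hy : LipschitzOnWith Ly y W) (hyM : ∀ θ ∈ W, y θ ∈ states D M) {f : Θ → ℝ} {Lf : NNReal}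
    (hf : LipschitzWith Lf f) {κ : ℝ} (hκ : 1 ≤ κ) {z : ℝ → Θ → ℝ → D}
    (hz : ∀ᶠ ε in 𝓝[>] (0 : ℝ), ∀ θ ∈ W,
      ContinuousOn (z ε θ) (Set.Icc (T - κ * ε) (T - κ * ε + ε)) ∧
      (∀ t ∈ Set.Icc (T - κ * ε) (T - κ * ε + ε), z ε θ t ∈ states D M) ∧
      ∀ t ∈ Set.Ioo (T - κ * ε) (T - κ * ε + ε),
        HasDerivAt (z ε θ) ((B t + (f θ / ε) • C t) (z ε θ t)) t)
    (h0 : TendsToZeroLip W fun ε θ => z ε θ (T - κ * ε) - y θ) :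
    (∃ L : NNReal, LipschitzOnWith L (fun θ => U (f θ) (y θ)) W) ∧
    TendsToZeroLip W fun ε θ => z ε θ (T - κ * ε + ε) - U (f θ) (y θ) := by
  obtain ⟨Cf', hCf'⟩ := hW.exists_bound_of_continuousOn hf.continuous.continuousOn
  set Cf := |Cf'|
  have hCf : ∀ θ ∈ W, |f θ| ≤ Cf := fun θ hθ => (hCf' θ hθ).trans (le_abs_self _)
  have hCf0 : 0 ≤ Cf := abs_nonneg _
  -- All frozen orbits that occur lie in this compact set.
  set K : Set D := (fun q : ℝ × Θ => U q.1 (y q.2)) '' (Set.Icc (-Cf) Cf ×ˢ W) with hKdef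
  have hK : IsCompact K := by
    refine (isCompact_Icc.prod hW).image_of_continuousOn ?_
    exact hU.continuous_uncurry.comp_continuousOn
      (continuousOn_fst.prodMk (hy.continuousOn.comp continuousOn_snd fun q hq => hq.2))
  have hKM : K ⊆ states D M := by
    rintro _ ⟨q, hq, rfl⟩
    exact hUM _ _ (hyM _ hq.2)
  have hmemK : ∀ τ, |τ| ≤ Cf → ∀ θ ∈ W, U τ (y θ) ∈ K := fun τ hτ θ hθ =>
    ⟨(τ, θ), ⟨abs_le.1 hτ, hθ⟩, rfl⟩
  obtain ⟨CA, hCA0, hCA⟩ := hC.exists_norm_le_compact hM hT hK hKM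
  obtain ⟨CB, hCB0, hCB⟩ := hB.exists_norm_le_compact hM hT hK hKM
  obtain ⟨LB, hLB0, hLB⟩ := hB.exists_lipschitz_compact hM hT hK hKM
  set L' : ℝ := Ly + Lf * CA
  have hL'0 : 0 ≤ L' := by positivity
  have hflip : ∀ σ ∈ Set.Icc (0 : ℝ) 1, ∀ θ ∈ W, ∀ θ' ∈ W,
      ‖U (σ * f θ) (y θ) - U (σ * f θ') (y θ')‖ ≤ L' * ‖θ - θ'‖ := by
    intro σ hσ θ hθ θ' hθ'
    have hσf : ∀ θ ∈ W, |σ * f θ| ≤ Cf := fun θ hθ => by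
      rw [abs_mul, abs_of_nonneg hσ.1]
      exact (mul_le_of_le_one_left (abs_nonneg _) hσ.2).trans (hCf θ hθ)
    have h1 : ‖U (σ * f θ) (y θ) - U (σ * f θ) (y θ')‖ ≤ Ly * ‖θ - θ'‖ := by
      rw [← map_sub, LinearIsometryEquiv.norm_map]
      exact hy.norm_sub_le hθ hθ'
    have h2 : ‖U (σ * f θ) (y θ') - U (σ * f θ') (y θ')‖ ≤ CA * ‖σ * f θ - σ * f θ'‖ := by
      refine (convex_Icc (-Cf) Cf).norm_image_sub_le_of_norm_hasDerivWithin_le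
        (f := fun τ => U τ (y θ')) (f' := fun τ => C T (U τ (y θ')))
        (fun τ _ => (hU.hasDerivAt (y θ') τ).hasDerivWithinAt)
        (fun τ hτ => hCA _ (hmemK τ (abs_le.2 hτ) θ' hθ')) (abs_le.1 (hσf θ' hθ'))
        (abs_le.1 (hσf θ hθ))
    have h3 : ‖σ * f θ - σ * f θ'‖ ≤ Lf * ‖θ - θ'‖ := by
      rw [← mul_sub, norm_mul, Real.norm_of_nonneg hσ.1]
      exact (mul_le_of_le_one_left (norm_nonneg _) hσ.2).trans (hf.norm_sub_le θ θ')
    have h4 : U (σ * f θ) (y θ) - U (σ * f θ') (y θ') =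
        (U (σ * f θ) (y θ) - U (σ * f θ) (y θ')) +
          (U (σ * f θ) (y θ') - U (σ * f θ') (y θ')) := by abel
    rw [h4]
    refine (norm_add_le _ _).trans ?_
    have h5 := mul_le_mul_of_nonneg_left h3 hCA0
    calc _ ≤ Ly * ‖θ - θ'‖ + CA * (Lf * ‖θ - θ'‖) := add_le_add h1 (h2.trans h5)
      _ = L' * ‖θ - θ'‖ := by simp only [L']; ring
  refine ⟨⟨⟨L', hL'0⟩, LipschitzOnWith.of_dist_le_mul fun θ hθ θ' hθ' => ?_⟩, ?_⟩
  · rw [dist_eq_norm, dist_eq_norm]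
    have := hflip 1 ⟨zero_le_one, le_rfl⟩ θ hθ θ' hθ'
    rwa [one_mul, one_mul] at this
  intro η hη
  -- Each error gets a quarter of the budget. `ζ` pays for the difference of amplitudes; `γ` pays
  -- for freezing `C`, the summands `1` and `L'` in its bound serving the pointwise and the
  -- Lipschitz estimate. Quarters of `min η δ` keep trajectories within `δ` of `K`, where `ζ` is
  -- valid.
  obtain ⟨ζ, hζ, hζη⟩ := exists_pos_mul_lt (show 0 < η / 4 by positivity) (Lf : ℝ)
  obtain ⟨δ, hδ, hCδ⟩ := hC.exists_norm_sub_le_compact hM hT hK hKM hζ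
  obtain ⟨γ, hγ, hγη⟩ := exists_pos_mul_lt (show 0 < min η δ / 4 by positivity) (Cf * (1 + L'))
  obtain ⟨δ₁, hδ₁, hCδ₁⟩ := hC.exists_norm_sub_le_compact hM hT hK hKM hγ
  obtain ⟨δ₂, hδ₂, hBδ₂⟩ := hB.exists_norm_sub_le_compact hM hT hK hKM one_pos
  obtain ⟨δ₃, hδ₃, hev⟩ := Metric.eventually_nhds_iff.1
    ((hC.eventually_lipschitz_compact hM hT hK hKM hγ).and
      ((hB.eventually_lipschitz_compact hM hT hK hKM one_pos).and (Ici_mem_nhds hT)))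
  have hsmall : ∀ a : ℝ, ∀ b > 0, ∀ᶠ ε in 𝓝[>] (0 : ℝ), a * ε < b := by
    intro a b hb
    have : Continuous fun ε : ℝ => a * ε := by fun_prop
    exact nhdsWithin_le_nhds ((this.tendsto' 0 0 (by simp)).eventually (gt_mem_nhds hb))
  filter_upwards [hz, h0 (min η δ / 4) (by positivity), self_mem_nhdsWithin, hsmall κ δ hδ,
    hsmall κ δ₁ hδ₁, hsmall κ δ₂ hδ₂, hsmall κ δ₃ hδ₃, hsmall (CB + 1) (min η δ / 4) (by positivity),
    hsmall ((LB + 1) * L') (η / 4) (by positivity)]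
    with ε hzε h0ε hε hκδ hκδ₁ hκδ₂ hκδ₃ hCBε hLBε
  have hε : 0 < ε := hε
  set s := T - κ * ε with hs
  have htT : ∀ t ∈ Set.Ioo s (s + ε), |t - T| < κ * ε := by
    intro t ht
    rw [abs_lt]
    constructor
    · linarith [ht.1]
    · have h1 := ht.2
      have h2 : ε ≤ κ * ε := le_mul_of_one_le_left hε.le hκ
      nlinarith
  -- The frozen flow, rescaled in time to run from `y θ` to `U (f θ) (y θ)` during the pulse.
  let w : Θ → ℝ → D := fun θ t => U ((t - s) / ε * f θ) (y θ)
  have hσ : ∀ t ∈ Set.Icc s (s + ε), (t - s) / ε ∈ Set.Icc (0 : ℝ) 1 := by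
    intro t ht
    exact ⟨div_nonneg (by linarith [ht.1]) hε.le, (div_le_one hε).2 (by linarith [ht.2])⟩
  have hwK : ∀ θ ∈ W, ∀ t ∈ Set.Icc s (s + ε), w θ t ∈ K := by
    intro θ hθ t ht
    refine hmemK _ ?_ θ hθ
    rw [abs_mul, abs_of_nonneg (hσ t ht).1]
    exact (mul_le_of_le_one_left (abs_nonneg _) (hσ t ht).2).trans (hCf θ hθ)
  have hw' : ∀ θ t, HasDerivAt (w θ) ((f θ / ε) • C T (w θ t)) t := by
    intro θ t
    have h1 : HasDerivAt (fun t : ℝ => (t - s) / ε * f θ) (f θ / ε) t := by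
      have := (((hasDerivAt_id t).sub_const s).div_const ε).mul_const (f θ)
      exact this.congr_deriv (by ring)
    exact HasDerivAt.scomp t (hU.hasDerivAt (y θ) _) h1
  have hwc : ∀ θ, ContinuousOn (w θ) (Set.Icc s (s + ε)) := fun θ t _ =>
    (hw' θ t).continuousAt.continuousWithinAt
  have hws : ∀ θ, w θ s = y θ := fun θ => by simp [w, hU.map_zero]
  have hwe : ∀ θ, w θ (s + ε) = U (f θ) (y θ) := fun θ => by
    simp only [w, add_sub_cancel_left, div_self hε.ne', one_mul]
  have hevt : ∀ t ∈ Set.Ioo s (s + ε), _ := fun t ht =>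
    @hev t (by rw [Real.dist_eq]; exact (htT t ht).trans hκδ₃)
  have hBs' : ∀ t ∈ Set.Ioo s (s + ε), IsSkewHermitian (B t) := fun t ht => hBs t (hevt t ht).2.2
  have hCs' : ∀ t ∈ Set.Ioo s (s + ε), IsSkewHermitian (C t) := fun t ht => hCs t (hevt t ht).2.2
  have hmin1 : min η δ ≤ η := min_le_left _ _
  have hmin2 : min η δ ≤ δ := min_le_right _ _
  have hfirst : ∀ θ ∈ W, ∀ t ∈ Set.Icc s (s + ε),
      ‖z ε θ t - w θ t‖ < min η δ := by
    intro θ hθ t ht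
    obtain ⟨hzc, hzM, hz'⟩ := hzε θ hθ
    have h1 := norm_sub_le_of_strong_control hε hBs' hCs' hzc (hwc θ) hz'
      (fun t _ => hw' θ t) (β := CB + 1) (γ := γ) (by positivity) hγ.le
      (fun t ht => by
        have hwK' := hwK θ hθ t (Set.Ioo_subset_Icc_self ht)
        have h2 := hBδ₂ t ((htT t ht).trans hκδ₂) _ hwK' _ (hKM hwK') (by simpa using hδ₂)
        have h3 := hCB _ hwK'
        have h4 := norm_le_norm_add_norm_sub' (B t (w θ t)) (B T (w θ t))
        linarith)
      (fun t ht => by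
        have hwK' := hwK θ hθ t (Set.Ioo_subset_Icc_self ht)
        exact hCδ₁ t ((htT t ht).trans hκδ₁) _ hwK' _ (hKM hwK') (by simpa using hδ₁)) ht
    have h5 := (h0ε θ hθ).1
    rw [hws] at h1
    have h6 : |f θ| * γ ≤ Cf * (1 + L') * γ := by
      refine mul_le_mul_of_nonneg_right ((hCf θ hθ).trans ?_) hγ.le
      exact le_mul_of_one_le_right hCf0 (by linarith)
    nlinarith
  intro θ hθ
  refine ⟨?_, fun θ' hθ' => ?_⟩
  · have := hfirst θ hθ (s + ε) ⟨by linarith, le_rfl⟩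
    rw [hwe] at this
    linarith
  · obtain ⟨hzc, hzM, hz'⟩ := hzε θ hθ
    obtain ⟨hzc₂, hzM₂, hz₂'⟩ := hzε θ' hθ'
    have hℓ := norm_nonneg (θ - θ')
    have hww : ∀ t ∈ Set.Ioo s (s + ε), ‖w θ t - w θ' t‖ ≤ L' * ‖θ - θ'‖ := fun t ht =>
      hflip _ (hσ t (Set.Ioo_subset_Icc_self ht)) θ hθ θ' hθ'
    have h1 := norm_sub_sub_le_of_strong_control hε hBs' hCs' hzc (hwc θ) hzc₂ (hwc θ') hz'
      (fun t _ => hw' θ t) hz₂' (fun t _ => hw' θ' t) (β := (LB + 1) * (L' * ‖θ - θ'‖))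
      (γ := γ * (L' * ‖θ - θ'‖)) (ζ := ζ) (by positivity) (by positivity) hζ.le
      (fun t ht => by
        have hK1 := hwK θ hθ t (Set.Ioo_subset_Icc_self ht)
        have hK2 := hwK θ' hθ' t (Set.Ioo_subset_Icc_self ht)
        have h2 := (hevt t ht).2.1 _ hK1 _ hK2
        have h3 := hLB _ hK1 _ hK2
        have h4 : B t (w θ t) - B t (w θ' t) = ((B t (w θ t) - B T (w θ t)) -
          (B t (w θ' t) - B T (w θ' t))) + (B T (w θ t) - B T (w θ' t)) := by abel
        rw [h4]
        refine (norm_add_le _ _).trans ?_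
        have h5 := mul_le_mul_of_nonneg_left (hww t ht) (show 0 ≤ LB + 1 by positivity)
        linarith)
      (fun t ht => by
        have hK1 := hwK θ hθ t (Set.Ioo_subset_Icc_self ht)
        have hK2 := hwK θ' hθ' t (Set.Ioo_subset_Icc_self ht)
        exact ((hevt t ht).1 _ hK1 _ hK2).trans (mul_le_mul_of_nonneg_left (hww t ht) hγ.le))
      (fun t ht => hCδ t ((htT t ht).trans hκδ) _ (hwK θ' hθ' t (Set.Ioo_subset_Icc_self ht)) _
        (hzM₂ t (Set.Ioo_subset_Icc_self ht))
        ((hfirst θ' hθ' t (Set.Ioo_subset_Icc_self ht)).trans_le hmin2))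
    rw [hwe, hwe, hws, hws] at h1
    have h2 := (h0ε θ hθ).2 θ' hθ'
    have h3 : |f θ - f θ'| * ζ ≤ η / 4 * ‖θ - θ'‖ := by
      have := mul_le_mul_of_nonneg_right (hf.norm_sub_le θ θ') hζ.le
      rw [Real.norm_eq_abs] at this
      nlinarith
    have h4 : |f θ| * (γ * (L' * ‖θ - θ'‖)) ≤ η / 4 * ‖θ - θ'‖ := by
      have h5 : |f θ| * (γ * L') ≤ η / 4 := by
        have h6 : |f θ| * (γ * L') ≤ Cf * (γ * L') :=
          mul_le_mul_of_nonneg_right (hCf θ hθ) (by positivity)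
        have h7 : 0 ≤ Cf * γ := by positivity
        nlinarith
      calc _ = |f θ| * (γ * L') * ‖θ - θ'‖ := by ring
        _ ≤ _ := mul_le_mul_of_nonneg_right h5 hℓ
    have h5 : ε * ((LB + 1) * (L' * ‖θ - θ'‖)) ≤ η / 4 * ‖θ - θ'‖ := by
      calc _ = (LB + 1) * L' * ε * ‖θ - θ'‖ := by ring
        _ ≤ _ := mul_le_mul_of_nonneg_right hLBε.le hℓ
    have h6 : min η δ / 4 * ‖θ - θ'‖ ≤ η / 4 * ‖θ - θ'‖ :=
      mul_le_mul_of_nonneg_right (by linarith) hℓ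
    linarith

end StepEstimate

/-! ### Lipschitz-small perturbations of a submersion. -/

section Perturbation

variable {D E Θ : Type*} [NormedAddCommGroup D] [NormedSpace ℝ D] [NormedAddCommGroup E]
  [NormedSpace ℝ E] [FiniteDimensional ℝ E] [NormedAddCommGroup Θ] [NormedSpace ℝ Θ]
  [FiniteDimensional ℝ Θ]

/-- A Lipschitz-small perturbation of a submersion onto `N` still reaches the base point. -/
theorem TendsToZeroLip.eventually_exists_eq {N s : Set D} {χ : D} {P : D →L[ℝ] E} {Φ : Θ → D}
    {L : Θ →L[ℝ] D} {F : ℝ → Θ → D} (hs : s ∈ 𝓝[N] χ) (hχ : χ ∈ N) (hinj : Set.InjOn P s)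
    (hΦ : HasStrictFDerivAt Φ L 0) (hΦ0 : Φ 0 = χ) (hsurj : Function.Surjective (P.comp L))
    (hF : TendsToZeroLip (Metric.closedBall 0 1) fun ε θ => F ε θ - Φ θ)
    (hFN : ∀ᶠ ε in 𝓝[>] (0 : ℝ), ∀ θ ∈ Metric.closedBall (0 : Θ) 1, F ε θ ∈ N) :
    ∀ᶠ ε in 𝓝[>] (0 : ℝ), ∃ θ ∈ Metric.closedBall (0 : Θ) 1, F ε θ = χ := by
  have : CompleteSpace E := FiniteDimensional.complete ℝ E
  have : CompleteSpace Θ := FiniteDimensional.complete ℝ Θ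
  have hPΦ : HasStrictFDerivAt (fun θ => P (Φ θ)) (P.comp L) 0 := P.hasStrictFDerivAt.comp 0 hΦ
  have hrange := LinearMap.range_eq_top.2 hsurj
  set R := (P.comp L).nonlinearRightInverseOfSurjective hrange
  have hRpos : 0 < R.nnnorm := ContinuousLinearMap.nonlinearRightInverseOfSurjective_nnnorm_pos _ _
  -- Strict differentiability costs `c` and the perturbation another `c`. Out of `R.nnnorm⁻¹ = 4 c`
  -- there remains `2 c`, so the image of the ball of radius `ρ` covers a ball of radius `2 c ρ`.
  set c : NNReal := R.nnnorm⁻¹ / 4 with hc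
  have hc0 : 0 < c := by positivity
  obtain ⟨V, hV, happ⟩ := hPΦ.approximates_deriv_on_nhds (c := c) (Or.inr hc0)
  obtain ⟨δ, hδ, hδs⟩ := Metric.nhdsWithin_basis_ball.mem_iff.1 hs
  have hΦc : Φ ⁻¹' Metric.ball χ (δ / 2) ∈ 𝓝 (0 : Θ) :=
    hΦ.continuousAt (by rw [hΦ0]; exact Metric.ball_mem_nhds _ (by positivity))
  obtain ⟨ρ, hρ, hρsub⟩ := Metric.nhds_basis_closedBall.mem_iff.1
    (Filter.inter_mem (Filter.inter_mem hV hΦc) (Metric.closedBall_mem_nhds 0 one_pos))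
  obtain ⟨η₁, hη₁, hPη₁⟩ := exists_pos_mul_lt
    (show 0 < min (c : ℝ) (2 * c * ρ) by positivity) ‖P‖
  -- The bound `δ / 2` keeps the perturbed point within `δ` of `χ`, where `P` is injective on `N`;
  -- equality of images under `P` then gives equality of points.
  set η := min η₁ (δ / 2) with hη
  have hη0 : 0 < η := by positivity
  have hPη : ‖P‖ * η < min (c : ℝ) (2 * c * ρ) :=
    (mul_le_mul_of_nonneg_left (min_le_left _ _) (norm_nonneg _)).trans_lt hPη₁
  filter_upwards [hF η hη0, hFN] with ε hε hεN
  have hball : ∀ θ ∈ Metric.closedBall (0 : Θ) ρ, θ ∈ Metric.closedBall (0 : Θ) 1 :=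
    fun θ hθ => (hρsub hθ).2
  have h0 : (0 : Θ) ∈ Metric.closedBall (0 : Θ) ρ := Metric.mem_closedBall_self hρ.le
  have happ' : ApproximatesLinearOn (fun θ => P (F ε θ)) (P.comp L)
      (Metric.closedBall 0 ρ) (c + c) := by
    intro θ hθ θ' hθ'
    have h1 := happ θ (hρsub hθ).1.1 θ' (hρsub hθ').1.1
    have h2 := (hε θ (hball θ hθ)).2 θ' (hball θ' hθ')
    have h3 : P (F ε θ) - P (F ε θ') - P.comp L (θ - θ') =
        (P (Φ θ) - P (Φ θ') - P.comp L (θ - θ')) +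
          P ((F ε θ - Φ θ) - (F ε θ' - Φ θ')) := by
      simp only [map_sub]
      abel
    rw [h3]
    refine (norm_add_le _ _).trans ?_
    have h4 : ‖P ((F ε θ - Φ θ) - (F ε θ' - Φ θ'))‖ ≤ c * ‖θ - θ'‖ := by
      refine (P.le_opNorm _).trans ?_
      calc _ ≤ ‖P‖ * (η * ‖θ - θ'‖) := mul_le_mul_of_nonneg_left h2 (norm_nonneg _)
        _ = ‖P‖ * η * ‖θ - θ'‖ := by ring
        _ ≤ _ := mul_le_mul_of_nonneg_right (hPη.le.trans (min_le_left _ _)) (norm_nonneg _)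
    rw [NNReal.coe_add, add_mul]
    exact add_le_add h1 h4
  have hsurjOn := happ'.surjOn_closedBall_of_nonlinearRightInverse R (b := 0) hρ.le
    subset_rfl
  have hdist : ∀ θ ∈ Metric.closedBall (0 : Θ) ρ, ‖F ε θ - Φ θ‖ ≤ η :=
    fun θ hθ => (hε θ (hball θ hθ)).1
  obtain ⟨θ, hθ, hPθ⟩ := hsurjOn (a := P χ) (by
    rw [Metric.mem_closedBall, dist_comm, dist_eq_norm, ← map_sub]
    have h1 := hdist 0 h0
    rw [hΦ0] at h1
    have h2 : ((R.nnnorm⁻¹ : NNReal) : ℝ) = 4 * c := by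
      rw [hc]
      push_cast
      ring
    calc _ ≤ ‖P‖ * ‖F ε 0 - χ‖ := P.le_opNorm _
      _ ≤ ‖P‖ * η := mul_le_mul_of_nonneg_left h1 (norm_nonneg _)
      _ ≤ 2 * c * ρ := hPη.le.trans (min_le_right _ _)
      _ = _ := by
        rw [NNReal.coe_inv] at h2
        rw [h2]
        push_cast
        ring)
  refine ⟨θ, hball θ hθ, hinj (hδs ⟨?_, hεN θ (hball θ hθ)⟩) (mem_of_mem_nhdsWithin hχ hs) hPθ⟩
  rw [Metric.mem_ball]
  have h1 := hdist θ hθ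
  have h2 : dist (Φ θ) χ < δ / 2 := (hρsub hθ).1.2
  have h3 := dist_triangle (F ε θ) (Φ θ) χ
  rw [dist_eq_norm (F ε θ)] at h3
  have h4 : η ≤ δ / 2 := min_le_right _ _
  rw [dist_eq_norm (F ε θ)] at *
  linarith

end Perturbation

/-! ### Pulse controls for words and the steering argument. -/

section WordControls

variable {H : Type*} [NormedAddCommGroup H] [InnerProductSpace ℂ H] {m r : ℕ} {M : Set H}

/-- The control which applies the letters of a word one after the other, each for a time `ε` with
an amplitude proportional to `1 / ε`, ending at time `T`. -/
noncomputable def wordControl (T ε : ℝ) : List (Fin r × ℝ) → ℝ → Fin r → ℝ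
  | [], _ => 0
  | p :: w, t => if t < T - w.length * ε then Pi.single p.1 (p.2 / ε) else wordControl T ε w t

/-- The word control preceded by the zero control. -/
noncomputable def delayedWordControl (T ε : ℝ) (w : List (Fin r × ℝ)) (t : ℝ) : Fin r → ℝ :=
  if t < T - w.length * ε then 0 else wordControl T ε w t

theorem eventually_ite_lt_eq_left {u v : ℝ → Fin r → ℝ} {a t : ℝ} (ht : t < a) :
    (fun s => if s < a then u s else v s) =ᶠ[𝓝 t] u := by
  filter_upwards [gt_mem_nhds ht] with s hs
  simp [hs]

theorem eventually_ite_lt_eq_right {u v : ℝ → Fin r → ℝ} {a t : ℝ} (ht : a < t) :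
    (fun s => if s < a then u s else v s) =ᶠ[𝓝 t] v := by
  filter_upwards [lt_mem_nhds ht] with s hs
  simp [not_lt.2 hs.le]

theorem IsLocallyConstAt.congr {u v : ℝ → Fin r → ℝ} {t : ℝ} (hu : IsLocallyConstAt u t)
    (huv : v =ᶠ[𝓝 t] u) : IsLocallyConstAt v t := by
  filter_upwards [hu, huv] with s hs hs'
  rw [hs', hs, huv.self_of_nhds]

theorem isLocallyConstAt_const (c : Fin r → ℝ) (t : ℝ) : IsLocallyConstAt (fun _ => c) t :=
  Filter.Eventually.of_forall fun _ => rfl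

theorem exists_finset_ite {u v : ℝ → Fin r → ℝ} (a : ℝ)
    (hu : ∃ F : Finset ℝ, ∀ t ∉ F, IsLocallyConstAt u t)
    (hv : ∃ F : Finset ℝ, ∀ t ∉ F, IsLocallyConstAt v t) :
    ∃ F : Finset ℝ, ∀ t ∉ F, IsLocallyConstAt (fun s => if s < a then u s else v s) t := by
  classical
  obtain ⟨F, hF⟩ := hu
  obtain ⟨G, hG⟩ := hv
  refine ⟨insert a (F ∪ G), fun t ht => ?_⟩
  simp only [Finset.mem_insert, Finset.mem_union, not_or] at ht
  rcases lt_or_gt_of_ne ht.1 with h | h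
  · exact (hF t ht.2.1).congr (eventually_ite_lt_eq_left h)
  · exact (hG t ht.2.2).congr (eventually_ite_lt_eq_right h)

theorem exists_finset_wordControl (T ε : ℝ) (w : List (Fin r × ℝ)) :
    ∃ F : Finset ℝ, ∀ t ∉ F, IsLocallyConstAt (wordControl T ε w) t := by
  induction w with
  | nil => exact ⟨∅, fun t _ => isLocallyConstAt_const 0 t⟩
  | cons p w ih => exact exists_finset_ite _ ⟨∅, fun t _ => isLocallyConstAt_const _ t⟩ ih

theorem isPiecewiseConst_delayedWordControl (T ε : ℝ) (w : List (Fin r × ℝ)) (a b : ℝ) :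
    IsPiecewiseConst (delayedWordControl T ε w) a b := by
  obtain ⟨F, hF⟩ := exists_finset_ite (T - w.length * ε)
    ⟨∅, fun t _ => isLocallyConstAt_const 0 t⟩ (exists_finset_wordControl T ε w)
  exact ⟨F, fun t _ ht => hF t ht⟩

namespace ControlSystem

variable {S : ControlSystem H r}

theorem generator_zero (t : ℝ) : S.generator 0 t = S.drift t := by
  simp [generator]

theorem generator_single (l : Fin r) (a t : ℝ) :
    S.generator (Pi.single l a) t = S.drift t + a • S.control l t := by
  rw [generator, Finset.sum_eq_single l]
  · simp
  · intro i _ hi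
    simp [hi]
  · simp

theorem IsTrajectory.mono {u : ℝ → Fin r → ℝ} {a b a' b' : ℝ} {ψ : ℝ → S.domain}
    (h : S.IsTrajectory M u a b ψ) (ha : a ≤ a') (hb : b' ≤ b) :
    S.IsTrajectory M u a' b' ψ where
  continuousOn := h.continuousOn.mono (Set.Icc_subset_Icc ha hb)
  mem t ht := h.mem t (Set.Icc_subset_Icc ha hb ht)
  hasDerivAt t ht := h.hasDerivAt t (Set.Ioo_subset_Ioo ha hb ht)

theorem IsTrajectory.congr {u v : ℝ → Fin r → ℝ} {a b : ℝ} {ψ : ℝ → S.domain}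
    (h : S.IsTrajectory M u a b ψ) (huv : ∀ t ∈ Set.Ioo a b, u =ᶠ[𝓝 t] v) :
    S.IsTrajectory M v a b ψ where
  continuousOn := h.continuousOn
  mem := h.mem
  hasDerivAt t ht hv := by
    rw [← (huv t ht).self_of_nhds]
    exact h.hasDerivAt t ht (hv.congr (huv t ht))

theorem IsTrajectory.continuousOn' {u : ℝ → Fin r → ℝ} {a b : ℝ} {ψ : ℝ → S.domain}
    (h : S.IsTrajectory M u a b ψ) : ContinuousOn ψ (Set.Icc a b) := by
  rw [Topology.IsInducing.subtypeVal.continuousOn_iff]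
  exact h.continuousOn

theorem IsTrajectory.hasDerivAt_of_eventuallyEq {u : ℝ → Fin r → ℝ} {a b : ℝ} {ψ : ℝ → S.domain}
    (h : S.IsTrajectory M u a b ψ) {t : ℝ} (ht : t ∈ Set.Ioo a b) {c : Fin r → ℝ}
    (hc : u =ᶠ[𝓝 t] fun _ => c) : HasDerivAt ψ (S.generator c t (ψ t)) t := by
  rw [← hasDerivAt_coe_iff]
  have h1 := h.hasDerivAt t ht ((isLocallyConstAt_const c t).congr hc)
  rwa [hc.self_of_nhds] at h1

/-- Word controls steer, in the limit `ε ↓ 0`, along the word of the flows frozen at time `T`. -/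
theorem tendsToZeroLip_word {t₀ T : ℝ} (hT : t₀ < T) (hS : S.IsSystemOn t₀ m M)
    {U : Fin r → ℝ → (S.domain ≃ₗᵢ[ℂ] S.domain)} (hU : IsFlowSystem m M (fun l => S.control l T) U)
    {Θ : Type*} [NormedAddCommGroup Θ] {W : Set Θ} (hW : IsCompact W)
    (w : List (Fin r × (Θ → ℝ))) (hw : ∀ p ∈ w, ∃ K, LipschitzWith K p.2)
    {y : Θ → S.domain} {Ly : NNReal} (hy : LipschitzOnWith Ly y W)
    (hyM : ∀ θ ∈ W, y θ ∈ states S.domain M) {z : ℝ → Θ → ℝ → S.domain}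
    (hz : ∀ᶠ ε in 𝓝[>] (0 : ℝ), ∀ θ ∈ W,
      S.IsTrajectory M (wordControl T ε (evalWord w θ)) (T - w.length * ε) T (z ε θ))
    (h0 : TendsToZeroLip W fun ε θ => z ε θ (T - w.length * ε) - y θ) :
    TendsToZeroLip W fun ε θ => z ε θ T - flowWord U (evalWord w θ) (y θ) := by
  induction w generalizing y Ly with
  | nil => simpa [evalWord] using h0
  | cons p w ih =>
    obtain ⟨Lf, hf⟩ := hw p (by simp)
    -- The pulse of the first letter ends exactly when the control of the remaining word starts. The
    -- number of letters still to be applied plays the role of `κ`.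
    have hlen : ∀ ε : ℝ, T - ((p :: w).length : ℝ) * ε + ε = T - w.length * ε := by
      intro ε
      push_cast [List.length_cons]
      ring
    have hevlen : ∀ θ, (evalWord w θ).length = w.length := fun θ => by simp [evalWord]
    obtain ⟨⟨L, hL⟩, hstep⟩ := TendsToZeroLip.step hT hS.submanifold_inter hS.smooth_drift
      (hS.smooth_control p.1) hS.skew_drift (hS.skew_control p.1) (hU.isFlow p.1) (hU.mapsTo p.1)
      hW hy hyM hf (κ := ((p :: w).length : ℝ)) (by simp) (z := z) (by
        filter_upwards [hz, self_mem_nhdsWithin] with ε hε hε0 θ hθ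
        have hε0 : 0 < ε := hε0
        have htr := hε θ hθ
        have hsub : T - ((p :: w).length : ℝ) * ε + ε ≤ T := by
          rw [hlen]
          have : 0 ≤ (w.length : ℝ) * ε := by positivity
          linarith
        have htr' := htr.mono le_rfl hsub
        refine ⟨htr'.continuousOn', htr'.mem, fun t ht => ?_⟩
        rw [← generator_single]
        refine htr'.hasDerivAt_of_eventuallyEq ht ?_
        rw [hlen] at ht
        refine eventually_ite_lt_eq_left ?_
        change t < T - ((evalWord w θ).length : ℝ) * ε
        rw [hevlen]
        exact ht.2) h0
    simp only [hlen] at hstep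
    refine ih (fun q hq => hw q (by simp [hq])) hL (fun θ hθ => hU.mapsTo _ _ _ (hyM θ hθ)) ?_ hstep
    filter_upwards [hz, self_mem_nhdsWithin] with ε hε hε0 θ hθ
    have hε0 : 0 < ε := hε0
    have htr' := (hε θ hθ).mono (a' := T - w.length * ε) (by rw [← hlen]; linarith) le_rfl
    refine htr'.congr fun t ht => ?_
    refine eventually_ite_lt_eq_right ?_
    change T - ((evalWord w θ).length : ℝ) * ε < t
    rw [hevlen]
    exact ht.1

/-- Two trajectories under the zero control which start at the same point coincide. -/
theorem IsTrajectory.eq_of_zero {t₀ a b : ℝ} (hS : S.IsSystemOn t₀ m M) (ha : t₀ ≤ a)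
    (hab : a ≤ b) {ψ χ : ℝ → S.domain} (hψ : S.IsTrajectory M 0 a b ψ)
    (hχ : S.IsTrajectory M 0 a b χ) (h0 : ψ a = χ a) : ψ b = χ b := by
  have h := IsSkewHermitian.norm_sub_le_of_hasDerivAt (A := S.drift) (d := fun t => ψ t - χ t)
    (R := 0) (ρ := 0) hab le_rfl (fun t ht => hS.skew_drift t (ha.trans ht.1.le))
    (hψ.continuousOn'.sub hχ.continuousOn') (fun t ht => by
      have h1 := hψ.hasDerivAt_of_eventuallyEq ht (c := 0) Filter.EventuallyEq.rfl
      have h2 := hχ.hasDerivAt_of_eventuallyEq ht (c := 0) Filter.EventuallyEq.rfl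
      rw [generator_zero] at h1 h2
      refine (h1.sub h2).congr_deriv ?_
      simp) (by simp)
  rw [h0, sub_self, norm_zero, zero_mul, add_zero] at h
  exact sub_eq_zero.1 (norm_le_zero_iff.1 h)

/-- The control operators at a fixed time generate complete flows of isometries on `M ∩ D`. -/
theorem IsSystemOn.exists_isFlowSystem {t₀ T : ℝ} (hT : t₀ ≤ T) (hS : S.IsSystemOn t₀ m M) :
    ∃ U : Fin r → ℝ → (S.domain ≃ₗᵢ[ℂ] S.domain),
      IsFlowSystem m M (fun l => S.control l T) U := by
  have hex : ∀ l, ∃ U : ℝ → (S.domain ≃ₗᵢ[ℂ] S.domain), IsFlow (S.control l T) U := by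
    intro l
    obtain ⟨U, hU⟩ := (hS.analytic T hT).exists_exp (S.control l T)
      (LieSubalgebra.subset_lieSpan (Set.mem_insert_of_mem _ ⟨l, rfl⟩))
    exact hU.exists_isFlow
  choose U hU using hex
  refine ⟨U, hU, fun l => (hS.smooth_control l).isTangentField hT (hS.skew_control l T hT),
    fun l t x hx => ?_⟩
  -- The unitary group is only known to preserve `D`. Its orbits coincide with the complete integral
  -- curves in `M ∩ D`, so it preserves `M` too.
  obtain ⟨γ, hγ0, hγM, hγ⟩ := hS.complete_control l T hT x hx
  have h1 := (hU l).eq_of_hasDerivAt (hS.skew_control l T hT) hγ t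
  rw [hγ0] at h1
  change ((U l t x : S.domain) : H) ∈ M
  rw [h1]
  exact hγM t

theorem IsSystemOn.exists_trajectory_eq {t₀ T : ℝ} (hT : t₀ < T) (hS : S.IsSystemOn t₀ m M)
    (hB : ∀ ψ : S.domain, (ψ : H) ∈ M →
      Module.rank ℝ (restrictAt (S.lieB T) ψ) = (m : Cardinal))
    {ψ₀ χ : S.domain} (hψ₀ : (ψ₀ : H) ∈ M) (hχ : (χ : H) ∈ M) :
    ∃ (u : ℝ → Fin r → ℝ) (ψ : ℝ → S.domain), IsPiecewiseConst u t₀ T ∧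
      S.IsTrajectory M u t₀ T ψ ∧ ψ t₀ = ψ₀ ∧ ψ T = χ := by
  obtain ⟨U, hU⟩ := hS.exists_isFlowSystem hT.le
  have hD := (hS.analytic T hT.le).dense
  obtain ⟨ξ, hξ, hξ0⟩ := hS.dynamics t₀ T le_rfl hT.le 0
    ⟨∅, fun t _ _ => isLocallyConstAt_const 0 t⟩ ψ₀ hψ₀
  have hξT : ξ T ∈ states S.domain M := hξ.mem T ⟨hT.le, le_rfl⟩
  obtain ⟨v, hv⟩ := hU.exists_flowWord_eq hD hS.submanifold_inter hS.connected.isPreconnected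
    hS.dense_inter hB hξT hχ
  -- The submersion is taken at the target `χ`, where `v` ends, so `v` needs no parameters.
  obtain ⟨P, n, w, L, ⟨s, hs, hinj⟩, hw, hw0, hder, hsurj⟩ :=
    hU.exists_submersion hD hS.submanifold_inter hχ (hB χ hχ)
  set w' := constWord (Fin n → ℝ) v ++ w with hw'
  have hw'L : ∀ p ∈ w', ∃ K, LipschitzWith K p.2 := by
    intro p hp
    rcases List.mem_append.1 hp with hp | hp
    · obtain ⟨q, -, rfl⟩ := List.mem_map.1 hp
      exact ⟨0, LipschitzWith.const _⟩
    · exact hw p hp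
  have hex : ∀ (ε : ℝ) (θ : Fin n → ℝ), ∃ ψ : ℝ → S.domain,
      S.IsTrajectory M (delayedWordControl T ε (evalWord w' θ)) t₀ T ψ ∧ ψ t₀ = ψ₀ := fun ε θ =>
    hS.dynamics t₀ T le_rfl hT.le _ (isPiecewiseConst_delayedWordControl _ _ _ _ _) ψ₀ hψ₀
  -- The trajectories are chosen separately for each `ε` and `θ`; regularity in `θ` comes out of the
  -- estimates.
  choose z hz hz0 using hex
  have hlen : ∀ θ, (evalWord w' θ).length = w'.length := fun θ => by simp [evalWord]
  have hsmall : ∀ᶠ ε in 𝓝[>] (0 : ℝ), T - w'.length * ε ∈ Set.Icc t₀ T := by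
    have h1 : Continuous fun ε : ℝ => T - w'.length * ε := by fun_prop
    filter_upwards [nhdsWithin_le_nhds ((h1.tendsto' 0 T (by simp)).eventually (lt_mem_nhds hT)),
      self_mem_nhdsWithin] with ε h2 h3
    have h3 : 0 < ε := h3
    have h4 : 0 ≤ (w'.length : ℝ) * ε := by positivity
    exact ⟨h2.le, by linarith⟩
  -- Before the pulses begin the control is zero whatever `θ` is, so all trajectories agree with
  -- `ξ`. The initial error is therefore constant in `θ`, with Lipschitz constant zero.
  have hstart : ∀ᶠ ε in 𝓝[>] (0 : ℝ), ∀ θ, z ε θ (T - w'.length * ε) =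
      ξ (T - w'.length * ε) := by
    filter_upwards [hsmall] with ε hε θ
    refine IsTrajectory.eq_of_zero hS le_rfl hε.1 (((hz ε θ).mono le_rfl hε.2).congr fun t ht => ?_)
      (hξ.mono le_rfl hε.2) ((hz0 ε θ).trans hξ0.symm)
    refine eventually_ite_lt_eq_left ?_
    rw [hlen]
    exact ht.2
  have h0 : TendsToZeroLip (Metric.closedBall 0 1)
      fun ε θ => z ε θ (T - w'.length * ε) - ξ T := by
    intro η hη
    have h1 : Filter.Tendsto (fun ε : ℝ => T - w'.length * ε) (𝓝[>] 0) (𝓝[Set.Icc t₀ T] T) := by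
      have h2 : Continuous fun ε : ℝ => T - w'.length * ε := by fun_prop
      exact tendsto_nhdsWithin_iff.2
        ⟨(h2.tendsto' 0 T (by simp)).mono_left nhdsWithin_le_nhds, hsmall⟩
    have h3 := (hξ.continuousOn' T ⟨hT.le, le_rfl⟩).tendsto.comp h1
    filter_upwards [hstart, h3.eventually (Metric.closedBall_mem_nhds _ hη)] with ε h4 h5 θ _
    refine ⟨?_, fun θ' _ => ?_⟩
    · rw [h4, ← dist_eq_norm]
      exact h5
    · rw [h4, h4, sub_self, norm_zero]
      positivity
  have hlim := tendsToZeroLip_word hT hS hU (isCompact_closedBall (0 : Fin n → ℝ) 1) w' hw'L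
    (LipschitzWith.const (ξ T)).lipschitzOnWith (fun _ _ => hξT) (z := z) (by
      filter_upwards [hsmall] with ε hε θ _
      refine ((hz ε θ).mono hε.1 le_rfl).congr fun t ht => ?_
      refine eventually_ite_lt_eq_right ?_
      rw [hlen]
      exact ht.1) h0
  have hword : ∀ θ, flowWord U (evalWord w' θ) (ξ T) = flowWord U (evalWord w θ) χ := fun θ => by
    rw [hw', evalWord_append, evalWord_constWord, flowWord_append, hv]
  simp only [hword] at hlim
  obtain ⟨ε, θ, -, hθ⟩ := (TendsToZeroLip.eventually_exists_eq (F := fun ε θ => z ε θ T) hs hχ hinj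
    hder hw0 hsurj hlim
    (Filter.Eventually.of_forall fun ε θ _ => (hz ε θ).mem T ⟨hT.le, le_rfl⟩)).exists
  exact ⟨_, z ε θ, isPiecewiseConst_delayedWordControl _ _ _ _ _, hz ε θ, hz0 ε θ, hθ⟩

end ControlSystem

end WordControls

end QuantumControl

theorem corollary4p9 {H : Type*} [NormedAddCommGroup H] [InnerProductSpace ℂ H] [CompleteSpace H]
    {r m : ℕ} (S : QuantumControl.ControlSystem H r) (t₀ : ℝ) (M : Set H)
    (hS : S.IsSystemOn t₀ m M)
    (hB : ∀ t, t₀ ≤ t → ∀ ψ : S.domain, (ψ : H) ∈ M →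
      Module.rank ℝ (QuantumControl.restrictAt (S.lieB t) ψ) = (m : Cardinal)) :
    S.IsStronglyAnalyticallyControllable M t₀ := by
  intro T hT ψ₀ hψ₀
  ext χ
  constructor
  · rintro ⟨u, ψ, -, hψ, -, rfl⟩
    exact ⟨hψ.mem T ⟨hT.le, le_rfl⟩, (ψ T).2⟩
  · rintro ⟨hχM, hχD⟩
    obtain ⟨u, ψ, hu, hψ, h0, h1⟩ :=
      hS.exists_trajectory_eq hT (hB T hT.le) hψ₀ (χ := ⟨χ, hχD⟩) hχM
    exact ⟨u, ψ, hu, hψ, h0, congrArg Subtype.val h1⟩
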